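/- **Setting.** A graph $G=(V,E,w)$ is a finite directed graph with real edge weights in which a set of edges is marked ("frozen") as the *negative* edges. Every unmarked edge has non-negative weight; a marked edge counts as negative whatever its weight is. A vertex is negative if it has at least one negative outgoing edge. In the input graph an ordered pair of vertices is joined by at most one non-negative and at most one negative edge (in particular, simple digraphs are allowed). Paths may repeat vertices. Write $d_G(s,t)$ for the infimum of the weights of $(s,t)$-paths, $d_G^h(s,t)$ for the infimum over $(s,t)$-paths with at most $h$ negative edges (counted with multiplicity), and $d_G^-(s,t)$ for the infimum over $(s,t)$-paths all of whose edges, except possibly the first, are non-negative edges; these are values in $[-\infty,+\infty]$, with $\inf\emptyset=+\infty$. A vertex $v$ is between $(s,t)$ if $d_G^0(s,v)+d_G^-(v,t)<0$, and the betweenness of $(s,t)$ is the number of vertices between $(s,t)$. **Theorem 3.1.** There are a deterministic algorithm and a constant $C$ such that the following holds for every graph $G=(V,E)$ with $n$ vertices, exactly $k$ of which are negative, each having exactly one negative outgoing edge, and for every real $b\ge 1$ such that all pairs $(s,t)\in V\times V$ have betweenness at most $k/b$. On input $G$ (given as a list of edges) the algorithm halts and outputs a graph $G'=(V',E')$ (parallel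 edges allowed) with $V'\supseteq V$ and $E'\supseteq E$, in which the edges of $G$ keep their end points, weights and markings and an edge of $E'\setminus E$ is a negative edge if and only if its weight is negative, such that 1. $d_{G'}(s,t)=d_G(s,t)$ for all $s,t\in V$; 2. $d_{G'}^{\,h-\lfloor h/3\rfloor}(s,t)\le d_G^{\,h}(s,t)$ for all $s,t\in V$ and all integers $h\ge 0$; 3. $|V'|=n+k$, and the negative vertices of $G'$ are exactly those of $G$. If $b\le k^2$, the running time is at most $C\,kn^2/\sqrt b$; if $b>k^2$, it is at most $C(n+1)^2$. Running time is the number of steps of a real RAM that may add, subtract and compare real numbers, and may add, subtract (truncated at $0$) and compare natural numbers and use them as addresses, each operation and memory access costing one step. -/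

import Mathlib

namespace HopReduction

/-! ### Weighted directed graphs with frozen negative edges -/

/-- A weighted directed (multi)graph with vertex set `V` and edge set `E`, in which a set of edges
has been marked (frozen) as the negative edges. Unmarked edges have non-negative weight; a marked
edge counts as negative whatever its current weight is. -/
structure FrozenGraph (V E : Type*) where
  src : E → V
  tgt : E → V
  weight : E → ℝ
  neg : E → Bool
  weight_nonneg : ∀ e, neg e = false → 0 ≤ weight e

namespace FrozenGraph

variable {V E : Type*} (G : FrozenGraph V E)

/-- The list of edges `p` is a walk from `s` to `t`. -/
def IsWalk : V → List E → V → Prop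
  | s, [], t => s = t
  | s, e :: p, t => G.src e = s ∧ IsWalk (G.tgt e) p t

/-- Total weight of a list of edges. -/
def walkWeight (p : List E) : ℝ := (p.map G.weight).sum

/-- Number of negative edges of a list of edges, with multiplicity. -/
def hops (p : List E) : ℕ := p.countP G.neg

/-- The distance `d(s,t)`: infimum of the weights of the walks from `s` to `t`
(`⊤` if there is none, `⊥` if the weights are unbounded below). -/
noncomputable def dist (s t : V) : EReal :=
  ⨅ (p : List E) (_ : G.IsWalk s p t), (G.walkWeight p : EReal)

/-- The `h`-negative hop distance `d^h(s,t)`: only walks with at most `h` negative edges. -/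
noncomputable def hopDist (h : ℕ) (s t : V) : EReal :=
  ⨅ (p : List E) (_ : G.IsWalk s p t ∧ G.hops p ≤ h), (G.walkWeight p : EReal)

/-- The distance `d⁻(s,t)`: only walks all of whose edges, except possibly the first one,
are non-negative edges. -/
noncomputable def firstNegDist (s t : V) : EReal :=
  ⨅ (p : List E) (_ : G.IsWalk s p t ∧ ∀ e ∈ p.tail, G.neg e = false), (G.walkWeight p : EReal)

/-- `v` is between the ordered pair `(s,t)`. -/
def IsBetween (s t v : V) : Prop := G.hopDist 0 s v + G.firstNegDist v t < 0

/-- The betweenness of the ordered pair `(s,t)`: the number of vertices between `s` and `t`. -/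
noncomputable def betweenness (s t : V) : ℕ := {v | G.IsBetween s t v}.ncard

/-- The negative vertices: those with at least one negative outgoing edge. -/
def negVertices : Set V := {v | ∃ e, G.src e = v ∧ G.neg e = true}

/-- Every negative vertex has exactly one negative outgoing edge. -/
def UniqueNegOut : Prop := ∀ v ∈ G.negVertices, ∃! e, G.src e = v ∧ G.neg e = true

/-- No two parallel edges of the same kind: an ordered pair of vertices is joined by at most one
non-negative edge and by at most one negative edge. -/
def NoDuplicateEdges : Prop :=
  ∀ e f, G.src e = G.src f → G.tgt e = G.tgt f → G.neg e = G.neg f → e = f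

/-- `G'` is a supergraph of `G`, along the inclusions `i` of the vertices and `j` of the edges:
old edges keep their end points, weight and marking, and a new edge of `G'` is a
negative edge exactly if its weight is negative. -/
structure IsSupergraph {V' E' : Type*} (G' : FrozenGraph V' E') (i : V ↪ V') (j : E ↪ E') :
    Prop where
  src_eq : ∀ e, G'.src (j e) = i (G.src e)
  tgt_eq : ∀ e, G'.tgt (j e) = i (G.tgt e)
  weight_eq : ∀ e, G'.weight (j e) = G.weight e
  neg_eq : ∀ e, G'.neg (j e) = G.neg e
  new_neg : ∀ e', e' ∉ Set.range j → (G'.neg e' = true ↔ G'.weight e' < 0)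

end FrozenGraph

/-! ### A deterministic real RAM

Programs work on natural-number registers and arrays (used for counting and addressing) and on
real registers and arrays. Natural numbers can be added, subtracted (truncated) and compared, real
numbers can be added, subtracted and compared; nothing converts reals to natural numbers. A program
names registers and arrays by constants, hence uses finitely many of them. Every operation and
every memory access costs one step. -/

/-- Memory of the machine: registers and (unbounded) arrays for both sorts. -/
structure State where
  reg : ℕ → ℕ
  arr : ℕ → ℕ → ℕ
  rreg : ℕ → ℝ
  rarr : ℕ → ℕ → ℝ

/-- Natural-number expressions; `get a i` is the entry of index `i` of array number `a`. -/
inductive NatExpr where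
  | const (c : ℕ)
  | reg (x : ℕ)
  | get (a : ℕ) (i : NatExpr)
  | add (e f : NatExpr)
  | sub (e f : NatExpr)

/-- Real expressions. -/
inductive RealExpr where
  | zero
  | reg (x : ℕ)
  | get (a : ℕ) (i : NatExpr)
  | add (e f : RealExpr)
  | sub (e f : RealExpr)

/-- Tests. -/
inductive Test where
  | natLt (e f : NatExpr)
  | realLt (e f : RealExpr)
  | not (t : Test)
  | and (t u : Test)

/-- Programs. -/
inductive Program where
  | skip
  | setReg (x : ℕ) (e : NatExpr)
  | setArr (a : ℕ) (i e : NatExpr)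
  | setRReg (x : ℕ) (e : RealExpr)
  | setRArr (a : ℕ) (i : NatExpr) (e : RealExpr)
  | seq (P Q : Program)
  | ite (t : Test) (P Q : Program)
  | loop (t : Test) (P : Program)

namespace NatExpr

def eval (σ : State) : NatExpr → ℕ
  | const c => c
  | reg x => σ.reg x
  | get a i => σ.arr a (i.eval σ)
  | add e f => e.eval σ + f.eval σ
  | sub e f => e.eval σ - f.eval σ

def cost : NatExpr → ℕ
  | const _ => 1
  | reg _ => 1
  | get _ i => i.cost + 1
  | add e f => e.cost + f.cost + 1
  | sub e f => e.cost + f.cost + 1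

end NatExpr

namespace RealExpr

noncomputable def eval (σ : State) : RealExpr → ℝ
  | zero => 0
  | reg x => σ.rreg x
  | get a i => σ.rarr a (i.eval σ)
  | add e f => e.eval σ + f.eval σ
  | sub e f => e.eval σ - f.eval σ

def cost : RealExpr → ℕ
  | zero => 1
  | reg _ => 1
  | get _ i => i.cost + 1
  | add e f => e.cost + f.cost + 1
  | sub e f => e.cost + f.cost + 1

end RealExpr

namespace Test

def Holds (σ : State) : Test → Prop
  | natLt e f => e.eval σ < f.eval σ
  | realLt e f => e.eval σ < f.eval σ
  | not t => ¬ t.Holds σ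
  | and t u => t.Holds σ ∧ u.Holds σ

def cost : Test → ℕ
  | natLt e f => e.cost + f.cost + 1
  | realLt e f => e.cost + f.cost + 1
  | not t => t.cost + 1
  | and t u => t.cost + u.cost + 1

end Test

namespace State

def setReg (σ : State) (x v : ℕ) : State :=
  { σ with reg := Function.update σ.reg x v }

def setArr (σ : State) (a i v : ℕ) : State :=
  { σ with arr := Function.update σ.arr a (Function.update (σ.arr a) i v) }

def setRReg (σ : State) (x : ℕ) (v : ℝ) : State :=
  { σ with rreg := Function.update σ.rreg x v }

def setRArr (σ : State) (a i : ℕ) (v : ℝ) : State :=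
  { σ with rarr := Function.update σ.rarr a (Function.update (σ.rarr a) i v) }

end State

/-- `Exec P σ T σ'`: started in `σ`, the program `P` halts after exactly `T` steps in `σ'`. -/
inductive Exec : Program → State → ℕ → State → Prop where
  | skip (σ) : Exec .skip σ 1 σ
  | setReg (σ x e) : Exec (.setReg x e) σ (e.cost + 1) (σ.setReg x (e.eval σ))
  | setArr (σ a i e) :
      Exec (.setArr a i e) σ (i.cost + e.cost + 1) (σ.setArr a (i.eval σ) (e.eval σ))
  | setRReg (σ x e) : Exec (.setRReg x e) σ (e.cost + 1) (σ.setRReg x (e.eval σ))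
  | setRArr (σ a i e) :
      Exec (.setRArr a i e) σ (i.cost + e.cost + 1) (σ.setRArr a (i.eval σ) (e.eval σ))
  | seq {P Q σ T₁ σ₁ T₂ σ₂} :
      Exec P σ T₁ σ₁ → Exec Q σ₁ T₂ σ₂ → Exec (.seq P Q) σ (T₁ + T₂) σ₂
  | ite_true {t P Q σ T σ'} :
      t.Holds σ → Exec P σ T σ' → Exec (.ite t P Q) σ (t.cost + T) σ'
  | ite_false {t P Q σ T σ'} :
      ¬ t.Holds σ → Exec Q σ T σ' → Exec (.ite t P Q) σ (t.cost + T) σ'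
  | loop_done {t P σ} : ¬ t.Holds σ → Exec (.loop t P) σ t.cost σ
  | loop_step {t P σ T₁ σ₁ T₂ σ₂} :
      t.Holds σ → Exec P σ T₁ σ₁ → Exec (.loop t P) σ₁ T₂ σ₂ →
      Exec (.loop t P) σ (t.cost + T₁ + T₂) σ₂

/-- The machine is deterministic. -/
theorem Exec.deterministic {P : Program} {σ σ₁ σ₂ : State} {T₁ T₂ : ℕ}
    (h₁ : Exec P σ T₁ σ₁) (h₂ : Exec P σ T₂ σ₂) : T₁ = T₂ ∧ σ₁ = σ₂ := by
  induction h₁ generalizing T₂ σ₂ with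
  | skip => cases h₂; exact ⟨rfl, rfl⟩
  | setReg => cases h₂; exact ⟨rfl, rfl⟩
  | setArr => cases h₂; exact ⟨rfl, rfl⟩
  | setRReg => cases h₂; exact ⟨rfl, rfl⟩
  | setRArr => cases h₂; exact ⟨rfl, rfl⟩
  | seq _ _ ih₁ ih₂ =>
    cases h₂ with
    | seq a b =>
      obtain ⟨rfl, rfl⟩ := ih₁ a
      obtain ⟨rfl, rfl⟩ := ih₂ b
      exact ⟨rfl, rfl⟩
  | ite_true ht _ ih =>
    cases h₂ with
    | ite_true _ a => obtain ⟨rfl, rfl⟩ := ih a; exact ⟨rfl, rfl⟩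
    | ite_false hf _ => exact absurd ht hf
  | ite_false hf _ ih =>
    cases h₂ with
    | ite_true ht _ => exact absurd ht hf
    | ite_false _ a => obtain ⟨rfl, rfl⟩ := ih a; exact ⟨rfl, rfl⟩
  | loop_done hf =>
    cases h₂ with
    | loop_done _ => exact ⟨rfl, rfl⟩
    | loop_step ht _ _ => exact absurd ht hf
  | loop_step ht _ _ ih₁ ih₂ =>
    cases h₂ with
    | loop_done hf => exact absurd ht hf
    | loop_step _ a b =>
      obtain ⟨rfl, rfl⟩ := ih₁ a
      obtain ⟨rfl, rfl⟩ := ih₂ b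
      exact ⟨rfl, rfl⟩

/-! ### Graphs as inputs and outputs -/

/-- The memory `σ` holds the graph `G` as a list of edges: register `0` holds the number of
vertices, register `1` the number of edges, and arrays `0`, `1`, `2` and real array `0` hold the
sources, the targets, the markings and the weights of the edges. -/
structure Encodes {n m : ℕ} (σ : State) (G : FrozenGraph (Fin n) (Fin m)) : Prop where
  vertices : σ.reg 0 = n
  edges : σ.reg 1 = m
  src : ∀ e : Fin m, σ.arr 0 e = (G.src e : ℕ)
  tgt : ∀ e : Fin m, σ.arr 1 e = (G.tgt e : ℕ)
  neg : ∀ e : Fin m, σ.arr 2 e = if G.neg e = true then 1 else 0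
  weight : ∀ e : Fin m, σ.rarr 0 e = G.weight e

/-- The initial memory for the input `G`: it holds `G`, and every other cell is `0`. -/
noncomputable def inputState {n m : ℕ} (G : FrozenGraph (Fin n) (Fin m)) : State where
  reg x := if x = 0 then n else if x = 1 then m else 0
  arr a i :=
    if h : i < m then
      if a = 0 then (G.src ⟨i, h⟩ : ℕ)
      else if a = 1 then (G.tgt ⟨i, h⟩ : ℕ)
      else if a = 2 then (if G.neg ⟨i, h⟩ = true then 1 else 0)
      else 0
    else 0
  rreg _ := 0
  rarr a i := if h : i < m then (if a = 0 then G.weight ⟨i, h⟩ else 0) else 0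

theorem encodes_inputState {n m : ℕ} (G : FrozenGraph (Fin n) (Fin m)) :
    Encodes (inputState G) G := by
  constructor <;> simp [inputState]

end HopReduction

/-! For each negative edge `(u, h)` of weight `w`, run Dijkstra's algorithm on the non-negative
edges twice in lockstep: backwards from `u` with labels `lB`, and forwards from `h` with labels
`lF`. Each round settles one vertex on both sides. The rounds stop when a side has no tentative
vertex left, or when the least tentative labels `lB b` and `lF f` satisfy `lB b + w + lF f ≥ 0`.

New edges. If the head of another negative edge is settled backwards, that edge, the shortest path
to `u` and `(u, h)` are merged into one edge. If the tail of another negative edge is settled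
forwards, `(u, h)` is merged with it in the same way. If both minima exist, a Steiner vertex `z`
receives edges `x → z` of weight `lB x - lB b` and `z → y` of weight `w + lF y + lB b`, for `x`, `y`
tentative on the backward and forward side. These weights are non-negative by minimality and by the
stopping rule.

Hop reduction (`IsBlock.shortcut`). Take three consecutive negative edges of a walk and the searches
around the middle one. If the head of the first or the tail of the third is settled, a merged edge
replaces two of the three. Otherwise both connecting paths pass through tentative vertices
(`SearchInv.exists_tentative`), and the detour through `z` replaces the middle edge without negative
edges and at no greater weight, since `lB b` cancels. So three negative edges become at most two,
and `IsSupergraph.hopDist_le` iterates this along the walk.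

Distances (`IsBlock.sound`, `IsSupergraph.dist_eq`). Every new edge is a walk of `G` up to a
potential: `z` stands for `u` with potential `lB b`, and original vertices have potential `0`.
Potentials telescope, so walks between original vertices project to walks of equal weight, even when
distances are `-∞`.

Running time (`IsBlock.sq_le`, `sum_rounds_mul_sqrt_le`). Every pair settled during `r` rounds has
`lB s + w + lF t < 0`, so `u` is between `(s, t)`, and there are `r ^ 2` such pairs. Summing over
`u` and exchanging sums gives `∑ r ^ 2 ≤ n ^ 2 * (k / b)`, and Cauchy–Schwarz gives `∑ r ≤ k * n /
√b`. With adjacency matrices a round costs `O(n)`. The program never sees `b`, which enters only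
this count. -/

namespace HopReduction

/-! ### Reasoning about programs -/

/-- `P` halts when started in `σ`, and its running time and final state satisfy `Q`. -/
def Runs (P : Program) (σ : State) (Q : ℕ → State → Prop) : Prop :=
  ∃ T σ', Exec P σ T σ' ∧ Q T σ'

namespace Program

/-- The natural-number registers that `P` may write. -/
def wReg : Program → List ℕ
  | skip => []
  | setReg x _ => [x]
  | setArr _ _ _ => []
  | setRReg _ _ => []
  | setRArr _ _ _ => []
  | seq P Q => wReg P ++ wReg Q
  | ite _ P Q => wReg P ++ wReg Q
  | loop _ P => wReg P

/-- The natural-number arrays that `P` may write. -/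
def wArr : Program → List ℕ
  | skip => []
  | setReg _ _ => []
  | setArr a _ _ => [a]
  | setRReg _ _ => []
  | setRArr _ _ _ => []
  | seq P Q => wArr P ++ wArr Q
  | ite _ P Q => wArr P ++ wArr Q
  | loop _ P => wArr P

/-- The real registers that `P` may write. -/
def wRReg : Program → List ℕ
  | skip => []
  | setReg _ _ => []
  | setArr _ _ _ => []
  | setRReg x _ => [x]
  | setRArr _ _ _ => []
  | seq P Q => wRReg P ++ wRReg Q
  | ite _ P Q => wRReg P ++ wRReg Q
  | loop _ P => wRReg P

/-- The real arrays that `P` may write. -/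
def wRArr : Program → List ℕ
  | skip => []
  | setReg _ _ => []
  | setArr _ _ _ => []
  | setRReg _ _ => []
  | setRArr a _ _ => [a]
  | seq P Q => wRArr P ++ wRArr Q
  | ite _ P Q => wRArr P ++ wRArr Q
  | loop _ P => wRArr P

/-- `for x := 0, …, reg B - 1 do P`. -/
def forLoop (x B : ℕ) (P : Program) : Program :=
  seq (setReg x (.const 0))
    (loop (.natLt (.reg x) (.reg B)) (seq P (setReg x (.add (.reg x) (.const 1)))))

end Program

/-- The states `σ` and `σ'` agree on everything that `P` does not write. -/
structure Frame (P : Program) (σ σ' : State) : Prop where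
  reg : ∀ x, x ∉ P.wReg → σ'.reg x = σ.reg x
  arr : ∀ a, a ∉ P.wArr → σ'.arr a = σ.arr a
  rreg : ∀ x, x ∉ P.wRReg → σ'.rreg x = σ.rreg x
  rarr : ∀ a, a ∉ P.wRArr → σ'.rarr a = σ.rarr a

namespace Frame

theorem refl (P : Program) (σ : State) : Frame P σ σ :=
  ⟨fun _ _ => rfl, fun _ _ => rfl, fun _ _ => rfl, fun _ _ => rfl⟩

theorem trans {P : Program} {σ₁ σ₂ σ₃ : State} (h : Frame P σ₁ σ₂) (h' : Frame P σ₂ σ₃) :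
    Frame P σ₁ σ₃ :=
  ⟨fun x hx => (h'.reg x hx).trans (h.reg x hx), fun x hx => (h'.arr x hx).trans (h.arr x hx),
    fun x hx => (h'.rreg x hx).trans (h.rreg x hx), fun x hx => (h'.rarr x hx).trans (h.rarr x hx)⟩

theorem mono {P Q : Program} {σ σ' : State} (h : Frame P σ σ')
    (h₁ : ∀ x ∈ P.wReg, x ∈ Q.wReg) (h₂ : ∀ x ∈ P.wArr, x ∈ Q.wArr)
    (h₃ : ∀ x ∈ P.wRReg, x ∈ Q.wRReg) (h₄ : ∀ x ∈ P.wRArr, x ∈ Q.wRArr) : Frame Q σ σ' :=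
  ⟨fun x hx => h.reg x (fun h' => hx (h₁ x h')), fun x hx => h.arr x (fun h' => hx (h₂ x h')),
    fun x hx => h.rreg x (fun h' => hx (h₃ x h')), fun x hx => h.rarr x (fun h' => hx (h₄ x h'))⟩

end Frame

namespace State

variable (σ : State) (x a i v y b j : ℕ) (r : ℝ)

@[simp] theorem setReg_reg : (σ.setReg x v).reg y = if y = x then v else σ.reg y := by
  simp [setReg, Function.update_apply]
@[simp] theorem setReg_arr : (σ.setReg x v).arr = σ.arr := rfl
@[simp] theorem setReg_rreg : (σ.setReg x v).rreg = σ.rreg := rfl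
@[simp] theorem setReg_rarr : (σ.setReg x v).rarr = σ.rarr := rfl
@[simp] theorem setArr_reg : (σ.setArr a i v).reg = σ.reg := rfl
@[simp] theorem setArr_arr :
    (σ.setArr a i v).arr b = if b = a then Function.update (σ.arr a) i v else σ.arr b := by
  simp [setArr, Function.update_apply]
@[simp] theorem setArr_rreg : (σ.setArr a i v).rreg = σ.rreg := rfl
@[simp] theorem setArr_rarr : (σ.setArr a i v).rarr = σ.rarr := rfl
@[simp] theorem setRReg_reg : (σ.setRReg x r).reg = σ.reg := rfl
@[simp] theorem setRReg_arr : (σ.setRReg x r).arr = σ.arr := rfl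
@[simp] theorem setRReg_rreg : (σ.setRReg x r).rreg y = if y = x then r else σ.rreg y := by
  simp [setRReg, Function.update_apply]
@[simp] theorem setRReg_rarr : (σ.setRReg x r).rarr = σ.rarr := rfl
@[simp] theorem setRArr_reg : (σ.setRArr a i r).reg = σ.reg := rfl
@[simp] theorem setRArr_arr : (σ.setRArr a i r).arr = σ.arr := rfl
@[simp] theorem setRArr_rreg : (σ.setRArr a i r).rreg = σ.rreg := rfl
@[simp] theorem setRArr_rarr :
    (σ.setRArr a i r).rarr b = if b = a then Function.update (σ.rarr a) i r else σ.rarr b := by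
  simp [setRArr, Function.update_apply]

end State

/-- The lists of written cells are computed from the syntax, so for a concrete program and cell the
side conditions of `Frame` are settled by `decide` or `simp`. -/
theorem Exec.frame {P : Program} {σ σ' : State} {T : ℕ} (h : Exec P σ T σ') : Frame P σ σ' := by
  induction h with
  | skip => exact Frame.refl _ _
  | setReg => constructor <;> intro y hy <;> simp_all [Program.wReg]
  | setArr => constructor <;> intro y hy <;> simp_all [Program.wArr]
  | setRReg => constructor <;> intro y hy <;> simp_all [Program.wRReg]
  | setRArr => constructor <;> intro y hy <;> simp_all [Program.wRArr]
  | seq _ _ ih₁ ih₂ =>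
    refine Frame.trans (ih₁.mono ?_ ?_ ?_ ?_) (ih₂.mono ?_ ?_ ?_ ?_) <;> intro y hy <;>
      simp_all [Program.wReg, Program.wArr, Program.wRReg, Program.wRArr]
  | ite_true _ _ ih =>
    refine ih.mono ?_ ?_ ?_ ?_ <;> intro y hy <;>
      simp_all [Program.wReg, Program.wArr, Program.wRReg, Program.wRArr]
  | ite_false _ _ ih =>
    refine ih.mono ?_ ?_ ?_ ?_ <;> intro y hy <;>
      simp_all [Program.wReg, Program.wArr, Program.wRReg, Program.wRArr]
  | loop_done => exact Frame.refl _ _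
  | loop_step _ _ _ ih₁ ih₂ =>
    refine Frame.trans (ih₁.mono ?_ ?_ ?_ ?_) ih₂ <;> intro y hy <;>
      simp_all [Program.wReg, Program.wArr, Program.wRReg, Program.wRArr]

namespace Runs

variable {P Q : Program} {σ : State} {R R' : ℕ → State → Prop}

/-- The continuation receives the frame condition for free, so specifications need not list what a
program leaves alone. -/
theorem mono (h : Runs P σ R) (hR : ∀ T σ', Frame P σ σ' → R T σ' → R' T σ') : Runs P σ R' := by
  obtain ⟨T, σ', he, hr⟩ := h
  exact ⟨T, σ', he, hR T σ' he.frame hr⟩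

theorem setReg {x e} (h : R (e.cost + 1) (σ.setReg x (e.eval σ))) : Runs (.setReg x e) σ R :=
  ⟨_, _, .setReg .., h⟩

theorem setArr {a i e} (h : R (i.cost + e.cost + 1) (σ.setArr a (i.eval σ) (e.eval σ))) :
    Runs (.setArr a i e) σ R :=
  ⟨_, _, .setArr .., h⟩

theorem setRReg {x e} (h : R (e.cost + 1) (σ.setRReg x (e.eval σ))) : Runs (.setRReg x e) σ R :=
  ⟨_, _, .setRReg .., h⟩

theorem setRArr {a i e} (h : R (i.cost + e.cost + 1) (σ.setRArr a (i.eval σ) (e.eval σ))) :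
    Runs (.setRArr a i e) σ R :=
  ⟨_, _, .setRArr .., h⟩

theorem skip (h : R 1 σ) : Runs .skip σ R := ⟨_, _, .skip _, h⟩

theorem seq (h : Runs P σ fun T σ' => Runs Q σ' fun T' σ'' => R (T + T') σ'') :
    Runs (.seq P Q) σ R := by
  obtain ⟨T, σ', he, T', σ'', he', hr⟩ := h
  exact ⟨_, _, .seq he he', hr⟩

theorem ite {t : Test} (h₁ : t.Holds σ → Runs P σ fun T σ' => R (t.cost + T) σ')
    (h₂ : ¬ t.Holds σ → Runs Q σ fun T σ' => R (t.cost + T) σ') : Runs (.ite t P Q) σ R := by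
  by_cases h : t.Holds σ
  · obtain ⟨T, σ', he, hr⟩ := h₁ h
    exact ⟨_, _, .ite_true h he, hr⟩
  · obtain ⟨T, σ', he, hr⟩ := h₂ h
    exact ⟨_, _, .ite_false h he, hr⟩

/-- A loop with an invariant `I i t`, where `i` counts the rounds and `t` the steps. -/
theorem loop {t : Test} (N : ℕ) (I : ℕ → ℕ → State → Prop) (h0 : I 0 0 σ)
    (hstep : ∀ i T τ, I i T τ → t.Holds τ → Frame P σ τ →
      i < N ∧ Runs P τ fun T' τ' => I (i + 1) (T + t.cost + T') τ') :
    Runs (.loop t P) σ fun T σ' => ∃ i T', T = T' + t.cost ∧ I i T' σ' ∧ ¬ t.Holds σ' := by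
  -- Induction on the number `d` of rounds that may remain; at `d = 0` the test must fail.
  suffices H : ∀ d i T τ, N ≤ i + d → I i T τ → Frame P σ τ →
      Runs (.loop t P) τ fun T₁ σ' => ∃ i T', T + T₁ = T' + t.cost ∧ I i T' σ' ∧ ¬ t.Holds σ' by
    simpa using H N 0 0 σ (by omega) h0 (Frame.refl _ _)
  intro d
  induction d with
  | zero =>
    intro i T τ hi hI hF
    have ht : ¬ t.Holds τ := fun ht => by
      have := (hstep i T τ hI ht hF).1
      omega
    exact ⟨_, _, .loop_done ht, i, T, rfl, hI, ht⟩
  | succ d ih =>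
    intro i T τ hi hI hF
    by_cases ht : t.Holds τ
    · obtain ⟨-, T', τ', he, hI'⟩ := hstep i T τ hI ht hF
      obtain ⟨T₁, σ', he', j, T₂, h, hI₂, hn⟩ :=
        ih (i + 1) _ τ' (by omega) hI' (hF.trans he.frame)
      exact ⟨_, _, .loop_step ht he he', j, T₂, by omega, hI₂, hn⟩
    · exact ⟨_, _, .loop_done ht, i, T, rfl, hI, ht⟩

/-- A `for` loop with an invariant `I i t`, where `t` counts the steps. -/
theorem forLoop {x B N : ℕ} (I : ℕ → ℕ → State → Prop) (hxB : x ≠ B) (hx : x ∉ P.wReg)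
    (hB : B ∉ P.wReg) (hN : σ.reg B = N) (h0 : I 0 2 (σ.setReg x 0))
    (hstep : ∀ i T τ, i < N → I i T τ → τ.reg x = i → τ.reg B = N →
      Frame (.forLoop x B P) σ τ →
      Runs P τ fun T' τ' => I (i + 1) (T + T' + 7) (τ'.setReg x (i + 1))) :
    Runs (.forLoop x B P) σ fun T σ' => ∃ T', T = T' + 3 ∧ I N T' σ' := by
  refine seq (setReg ?_)
  have hmono : ∀ {τ τ'}, Frame (.seq P (.setReg x (.add (.reg x) (.const 1)))) τ τ' →
      Frame (.forLoop x B P) τ τ' := fun h => by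
    refine h.mono ?_ ?_ ?_ ?_ <;> intro y hy <;>
      simp_all [Program.forLoop, Program.wReg, Program.wArr, Program.wRReg, Program.wRArr]
  -- Costs: 2 for the initial assignment, 3 for each test, 4 for each increment. Hence 7 extra steps
  -- per round and 3 for the final failing test.
  refine (loop (P := .seq P (.setReg x (.add (.reg x) (.const 1))))
    (t := .natLt (.reg x) (.reg B)) (σ := σ.setReg x 0) N
    (fun i T τ => i ≤ N ∧ τ.reg x = i ∧ τ.reg B = N ∧ I i (T + 2) τ) ?_ ?_).mono ?_
  · simp [hxB.symm, hN, h0]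
  · rintro i T τ ⟨hi, hxi, hBN, hI⟩ ht hF
    simp only [Test.Holds, NatExpr.eval, hxi, hBN] at ht
    refine ⟨ht, seq ((hstep i _ τ ht hI hxi hBN ?_).mono ?_)⟩
    · refine Frame.trans ?_ (hmono hF)
      constructor <;> intro y hy <;> simp_all [Program.forLoop, Program.wReg]
    · intro T' τ' hF' hI'
      have e1 : τ'.reg x = i := by rw [hF'.reg x hx, hxi]
      have e2 : τ'.reg B = N := by rw [hF'.reg B hB, hBN]
      refine setReg ?_
      simp only [NatExpr.eval, e1, NatExpr.cost, Test.cost, State.setReg_reg, hxB.symm, if_false,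
        if_true, e2, true_and]
      refine ⟨by omega, ?_⟩
      convert hI' using 1
      omega
  · rintro T σ' - ⟨i, T', hT, ⟨hi, hxi, hBN, hI⟩, hn⟩
    simp only [Test.Holds, NatExpr.eval, hxi, hBN, not_lt] at hn
    obtain rfl : i = N := le_antisymm hi hn
    exact ⟨_, by simp only [hT, NatExpr.cost, Test.cost]; omega, hI⟩

/-- A `for` loop with a bound `c` for the number of steps of each round. -/
theorem forLoop_le {x B N : ℕ} (c : ℕ) (I : ℕ → State → Prop) (hxB : x ≠ B) (hx : x ∉ P.wReg)
    (hB : B ∉ P.wReg) (hN : σ.reg B = N) (h0 : I 0 (σ.setReg x 0))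
    (hstep : ∀ i τ, i < N → I i τ → τ.reg x = i → τ.reg B = N →
      Frame (.forLoop x B P) σ τ →
      Runs P τ fun T' τ' => T' ≤ c ∧ I (i + 1) (τ'.setReg x (i + 1))) :
    Runs (.forLoop x B P) σ fun T σ' => T ≤ (c + 7) * N + 5 ∧ I N σ' := by
  refine (forLoop (fun i T τ => T ≤ (c + 7) * i + 2 ∧ I i τ) hxB hx hB hN ⟨by simp, h0⟩ ?_).mono ?_
  · rintro i T τ hi ⟨hT, hI⟩ hxi hBN hF
    refine (hstep i τ hi hI hxi hBN hF).mono ?_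
    rintro T' τ' - ⟨hT', hI'⟩
    refine ⟨?_, hI'⟩
    rw [mul_add]
    omega
  · rintro T σ' - ⟨T', rfl, h, hI⟩
    exact ⟨by omega, hI⟩

end Runs

/-! ### Shortest path search -/

/-- There is a path of length `W` from `x` to `y` along the weighted edges `A`. -/
inductive Path (A : ℕ → ℕ → ℝ → Prop) : ℕ → ℕ → ℝ → Prop
  | refl (x : ℕ) : Path A x x 0
  | snoc {x y z : ℕ} {W w : ℝ} : Path A x y W → A y z w → Path A x z (W + w)

namespace Path

variable {A : ℕ → ℕ → ℝ → Prop}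

theorem cons {x y z : ℕ} {w W : ℝ} (h : A x y w) (p : Path A y z W) : Path A x z (w + W) := by
  induction p with
  | refl => simpa using Path.snoc (Path.refl x) h
  | snoc _ h' ih => rw [← add_assoc]; exact ih.snoc h'

theorem reverse {x y : ℕ} {W : ℝ} (p : Path A x y W) : Path (fun a b w => A b a w) y x W := by
  induction p with
  | refl => exact .refl _
  | snoc _ h' ih => rw [add_comm]; exact ih.cons h'

theorem nonneg (hA : ∀ x y w, A x y w → 0 ≤ w) {x y : ℕ} {W : ℝ} (p : Path A x y W) : 0 ≤ W := by
  induction p with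
  | refl => exact le_rfl
  | snoc _ h' ih => exact add_nonneg ih (hA _ _ _ h')

end Path

/-- The invariant of Dijkstra's algorithm started at `r`: `stat x` is `0` if `x` is unseen, `1` if
`x` has a tentative label, and `2` if `x` is settled. -/
structure SearchInv (n : ℕ) (A : ℕ → ℕ → ℝ → Prop) (r : ℕ) (stat : ℕ → ℕ) (lab : ℕ → ℝ) :
    Prop where
  le_two : ∀ x < n, stat x ≤ 2
  root_seen : stat r ≠ 0
  root_lab : lab r ≤ 0
  path : ∀ x < n, stat x ≠ 0 → Path A r x (lab x)
  relax : ∀ x < n, stat x = 2 → ∀ y w, A x y w → stat y ≠ 0 ∧ lab y ≤ lab x + w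
  order : ∀ x < n, ∀ y < n, stat x = 2 → stat y = 1 → lab x ≤ lab y

/-- The edges `A` join numbers below `n`, and their weights are non-negative. -/
def Bounded (n : ℕ) (A : ℕ → ℕ → ℝ → Prop) : Prop := ∀ x y w, A x y w → x < n ∧ y < n ∧ 0 ≤ w

namespace SearchInv

variable {n r : ℕ} {A : ℕ → ℕ → ℝ → Prop} {stat : ℕ → ℕ} {lab : ℕ → ℝ}

theorem stat_eq_one (h : SearchInv n A r stat lab) {x : ℕ} (hx : x < n) (h0 : stat x ≠ 0)
    (h2 : stat x ≠ 2) : stat x = 1 := by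
  have := h.le_two x hx
  omega

/-- Every path from the root ends in a settled vertex, or leaves the settled vertices. -/
theorem cover (h : SearchInv n A r stat lab) (hA : Bounded n A) (hr : r < n) {x : ℕ} {W : ℝ}
    (p : Path A r x W) :
    (stat x = 2 ∧ lab x ≤ W) ∨
      ∃ y < n, stat y = 1 ∧ ∃ W₁, Path A y x W₁ ∧ lab y + W₁ ≤ W := by
  induction p with
  | refl =>
    by_cases h2 : stat r = 2
    · exact .inl ⟨h2, h.root_lab⟩
    · exact .inr ⟨r, hr, h.stat_eq_one hr h.root_seen h2, 0, .refl _, by simpa using h.root_lab⟩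
  | @snoc x z W w p e ih =>
    rcases ih with ⟨h2, hl⟩ | ⟨y, hy, h1, W₁, q, hq⟩
    · obtain ⟨hz, hlz⟩ := h.relax x (hA _ _ _ e).1 h2 z w e
      by_cases hz2 : stat z = 2
      · exact .inl ⟨hz2, by linarith⟩
      · exact .inr ⟨z, (hA _ _ _ e).2.1, h.stat_eq_one (hA _ _ _ e).2.1 hz hz2, 0, .refl _,
          by linarith⟩
    · exact .inr ⟨y, hy, h1, W₁ + w, q.snoc e, by linarith⟩

/-- If the path meets a tentative vertex, `order` puts the settled label below that vertex's label,
and the rest of the path has non-negative length. -/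
theorem lab_le (h : SearchInv n A r stat lab) (hA : Bounded n A) (hr : r < n) {x : ℕ} (hx : x < n)
    (h2 : stat x = 2) {W : ℝ} (p : Path A r x W) : lab x ≤ W := by
  rcases h.cover hA hr p with h' | ⟨y, hy, h1, W₁, q, hq⟩
  · exact h'.2
  · have := h.order x hx y hy h2 h1
    have := q.nonneg fun _ _ _ e => (hA _ _ _ e).2.2
    linarith

/-- Supplies the entry and exit of the detour through the Steiner vertex: a tentative vertex that
lies on the given path, up to replacing an initial segment by one that is no longer. -/
theorem exists_tentative (h : SearchInv n A r stat lab) (hA : Bounded n A) (hr : r < n) {x : ℕ}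
    (h2 : stat x ≠ 2) {W : ℝ} (p : Path A r x W) :
    ∃ y < n, stat y = 1 ∧ ∃ W₁, Path A y x W₁ ∧ lab y + W₁ ≤ W := by
  rcases h.cover hA hr p with h' | h'
  · exact absurd h'.1 h2
  · exact h'

theorem init (hstat : ∀ x < n, stat x = if x = r then 1 else 0) (hr : r < n) (hlab : lab r = 0) :
    SearchInv n A r stat lab where
  le_two x hx := by rw [hstat x hx]; split <;> omega
  root_seen := by simp [hstat r hr]
  root_lab := hlab.le
  path x hx h := by
    rw [hstat x hx] at h
    obtain rfl : x = r := by by_contra hne; simp [hne] at h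
    rw [hlab]; exact .refl _
  relax x hx h := by rw [hstat x hx] at h; split at h <;> omega
  order x hx y _ h := by rw [hstat x hx] at h; split at h <;> omega

end SearchInv

namespace Program
open NatExpr Test

/-- Start a search from the vertex in register `r`. -/
def initSearch (S L r : ℕ) : Program :=
  seq (forLoop 5 0 (setArr S (.reg 5) (.const 0)))
    (seq (setArr S (.reg r) (.const 1)) (setRArr L (.reg r) .zero))

/-- Put into register `out` the vertex with the least tentative label (`n` if there is none). -/
def findMin (S L out : ℕ) : Program :=
  seq (setReg out (.reg 0))
    (forLoop 5 0
      -- There is no equality test and no disjunction: `0 < s < 2` means `s = 1`, and the negated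
      -- conjunction means that there is no candidate yet or that the label is smaller than the
      -- candidate's.
      (ite (.and (natLt (.const 0) (.get S (.reg 5))) (.and (natLt (.get S (.reg 5)) (.const 2))
          (.not (.and (natLt (.reg out) (.reg 0))
            (.not (realLt (.get L (.reg 5)) (.get L (.reg out))))))))
        (setReg out (.reg 5)) skip))

/-- Settle the vertex in register `b`, where arrays `fa` and `wa` hold the adjacency matrix. -/
def settle (S L fa wa b : ℕ) : Program :=
  seq (setArr S (.reg b) (.const 2))
    (forLoop 5 0
      -- The negated conjunction means that the neighbour is unseen or that its label strictly
      -- improves.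
      (ite (.and (natLt (.const 0) (.get fa (.add (.get 3 (.reg b)) (.reg 5))))
          (.not (.and (natLt (.const 0) (.get S (.reg 5)))
            (.not (realLt
              (.add (.get L (.reg b)) (.get wa (.add (.get 3 (.reg b)) (.reg 5))))
              (.get L (.reg 5)))))))
        (seq (setRArr L (.reg 5)
            (.add (.get L (.reg b)) (.get wa (.add (.get 3 (.reg b)) (.reg 5)))))
          (setArr S (.reg 5) (.const 1)))
        skip))

end Program

/-- Arrays `fa` and `wa` hold the adjacency matrix of `A`, and array `3` the row offsets. -/
structure HoldsMatrix (σ : State) (n : ℕ) (A : ℕ → ℕ → ℝ → Prop) (fa wa : ℕ) : Prop where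
  offset : ∀ x < n, σ.arr 3 x = x * n
  entry : ∀ x < n, ∀ y < n, ∀ w,
    A x y w ↔ σ.arr fa (x * n + y) ≠ 0 ∧ σ.rarr wa (x * n + y) = w

theorem runs_initSearch {σ : State} {n r S L : ℕ} (hn : σ.reg 0 = n) (hr : σ.reg r < n)
    (hr5 : r ≠ 5) (A : ℕ → ℕ → ℝ → Prop) :
    Runs (.initSearch S L r) σ fun T σ' => T ≤ 11 * n + 12 ∧
      (∀ x < n, σ'.arr S x = if x = σ.reg r then 1 else 0) ∧
      SearchInv n A (σ.reg r) (σ'.arr S) (σ'.rarr L) := by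
  refine .seq ((Runs.forLoop_le (N := n) 3 (fun i τ => ∀ x < i, τ.arr S x = 0) (by simp)
    (by simp [Program.wReg]) (by simp [Program.wReg]) hn (by simp) ?_).mono ?_)
  · intro i τ hi hI h5 h0 hF
    refine .setArr ⟨by simp [NatExpr.cost], fun x hx => ?_⟩
    simp only [State.setReg_arr, State.setArr_arr, if_true, NatExpr.eval, h5,
      Function.update_apply]
    split_ifs with h
    · rfl
    · exact hI x (by omega)
  · rintro T σ' hF ⟨hT, hI⟩
    have hrr : σ'.reg r = σ.reg r := hF.reg r (by simp [Program.forLoop, Program.wReg, hr5])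
    refine .seq (.setArr (.setRArr ?_))
    have hs : ∀ x < n, Function.update (σ'.arr S) (σ.reg r) 1 x = if x = σ.reg r then 1 else 0 := by
      intro x hx
      rw [Function.update_apply, hI x hx]
    simp only [NatExpr.cost, RealExpr.cost, State.setRArr_arr, State.setArr_arr, if_true,
      NatExpr.eval, State.setRArr_rarr, State.setArr_reg, hrr, RealExpr.eval]
    exact ⟨by omega, hs, SearchInv.init hs hr (by simp)⟩

theorem runs_findMin {σ : State} {n S L out : ℕ} (hn : σ.reg 0 = n) (ho0 : out ≠ 0)
    (ho5 : out ≠ 5) :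
    Runs (.findMin S L out) σ fun T σ' => T ≤ 40 * n + 10 ∧
      ((σ'.reg out = n ∧ ∀ x < n, σ.arr S x ≠ 1) ∨
        (σ'.reg out < n ∧ σ.arr S (σ'.reg out) = 1 ∧
          ∀ x < n, σ.arr S x = 1 → σ.rarr L (σ'.reg out) ≤ σ.rarr L x)) := by
  refine .seq (.setReg ((Runs.forLoop_le (N := n) 30 (fun i τ =>
      (τ.reg out = n ∧ ∀ x < i, σ.arr S x ≠ 1) ∨
        (τ.reg out < n ∧ σ.arr S (τ.reg out) = 1 ∧
          ∀ x < i, σ.arr S x = 1 → σ.rarr L (τ.reg out) ≤ σ.rarr L x))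
    (by simp) (by simp [Program.wReg, ho5.symm]) (by simp [Program.wReg, ho0.symm]) ?_ ?_ ?_).mono
      ?_))
  · simp [ho0.symm, hn]
  · left; simp [ho5, hn, NatExpr.eval]
  · intro i τ hi hI h5 h0 hF
    have hS : τ.arr S = σ.arr S := hF.arr S (by simp [Program.forLoop, Program.wArr])
    have hL : τ.rarr L = σ.rarr L := hF.rarr L (by simp [Program.forLoop, Program.wRArr])
    refine .ite (fun ht => .setReg ?_) (fun ht => .skip ?_)
    · simp only [Test.Holds, NatExpr.eval, RealExpr.eval, hS, hL, h5, h0] at ht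
      simp only [State.setReg_reg, if_true, ho5, if_false, NatExpr.eval, h5]
      refine ⟨by simp [Test.cost, NatExpr.cost, RealExpr.cost], .inr ⟨hi, by omega, ?_⟩⟩
      intro x hx hx1
      rcases Nat.lt_succ_iff_lt_or_eq.1 hx with hx | rfl
      · rcases hI with hI | hI
        · exact absurd hx1 (hI.2 x hx)
        · have := hI.2.2 x hx hx1
          have := ht.2.2
          rw [not_and_not_right] at this
          linarith [this hI.1]
      · exact le_rfl
    · simp only [Test.Holds, NatExpr.eval, RealExpr.eval, hS, hL, h5, h0] at ht
      simp only [State.setReg_reg, ho5, if_false]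
      refine ⟨by simp [Test.cost, NatExpr.cost, RealExpr.cost], ?_⟩
      have key : σ.arr S i = 1 → τ.reg out < n ∧ σ.rarr L (τ.reg out) ≤ σ.rarr L i := by
        intro h1
        simp only [h1] at ht
        simpa using ht
      rcases hI with hI | hI
      · refine .inl ⟨hI.1, fun x hx hx1 => ?_⟩
        rcases Nat.lt_succ_iff_lt_or_eq.1 hx with hx | rfl
        · exact hI.2 x hx hx1
        · have := (key hx1).1
          omega
      · refine .inr ⟨hI.1, hI.2.1, fun x hx hx1 => ?_⟩
        rcases Nat.lt_succ_iff_lt_or_eq.1 hx with hx | rfl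
        · exact hI.2.2 x hx hx1
        · exact (key hx1).2
  · rintro T σ' hF ⟨hT, hI⟩
    refine ⟨?_, hI⟩
    simp only [NatExpr.cost]
    omega

theorem runs_settle {σ : State} {n r S L fa wa b : ℕ} {A : ℕ → ℕ → ℝ → Prop} (hn : σ.reg 0 = n)
    (hA : Bounded n A) (hM : HoldsMatrix σ n A fa wa) (hI : SearchInv n A r (σ.arr S) (σ.rarr L))
    (hbn : σ.reg b < n) (hb1 : σ.arr S (σ.reg b) = 1)
    (hmin : ∀ x < n, σ.arr S x = 1 → σ.rarr L (σ.reg b) ≤ σ.rarr L x)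
    (hb5 : b ≠ 5) (hS3 : S ≠ 3) (hSf : S ≠ fa) (hLw : L ≠ wa) :
    Runs (.settle S L fa wa b) σ fun T σ' => T ≤ 60 * n + 20 ∧
      SearchInv n A r (σ'.arr S) (σ'.rarr L) ∧
      (∀ x < n, σ'.arr S x = 2 ↔ σ.arr S x = 2 ∨ x = σ.reg b) ∧
      (∀ x < n, σ'.arr S x = 2 → σ'.rarr L x = σ.rarr L x) := by
  set c := σ.reg b with hc
  -- During relaxation the settled set is the old one plus `c`, and settled labels do not change.
  -- Seen vertices stay seen and labels never grow, labels are path lengths, tentative labels stay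
  -- at least that of `c`, and the edges from `c` to numbers below `i` are relaxed.
  refine .seq (.setArr ((Runs.forLoop_le (N := n) 50 (fun i τ =>
      (∀ x < n, τ.arr S x ≤ 2) ∧
      (∀ x < n, τ.arr S x = 2 ↔ σ.arr S x = 2 ∨ x = c) ∧
      (∀ x < n, τ.arr S x = 2 → τ.rarr L x = σ.rarr L x) ∧
      (∀ x < n, τ.arr S x ≠ 0 → Path A r x (τ.rarr L x)) ∧
      (∀ x, σ.arr S x ≠ 0 → τ.arr S x ≠ 0 ∧ τ.rarr L x ≤ σ.rarr L x) ∧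
      (∀ x < n, τ.arr S x = 1 → σ.rarr L c ≤ τ.rarr L x) ∧
      (∀ y < i, ∀ w, A c y w → τ.arr S y ≠ 0 ∧ τ.rarr L y ≤ σ.rarr L c + w))
    (by simp) (by simp [Program.wReg]) (by simp [Program.wReg]) ?_ ?_ ?_).mono ?_))
  · simp [hn]
  · simp only [State.setReg_arr, State.setArr_arr, if_true, NatExpr.eval, State.setReg_rarr,
      State.setArr_rarr, ← hc, Function.update_apply, Nat.not_lt_zero, false_imp_iff,
      implies_true, and_true]
    refine ⟨fun x hx => ?_, fun x hx => ?_, trivial, fun x hx h => ?_, ?_⟩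
    · have := hI.le_two x hx
      split_ifs <;> omega
    · split_ifs with h <;> simp [h]
    · split_ifs at h with h'
      · subst h'; exact hI.path _ hx (by omega)
      · exact hI.path x hx h
    · refine ⟨fun x h => ?_, fun x hx h => ?_⟩
      · refine ⟨?_, le_rfl⟩
        split_ifs
        exacts [two_ne_zero, h]
      · split_ifs at h with h'
        · exact absurd h (by norm_num)
        · exact hmin x hx h
  · rintro i τ hi ⟨i1, i2, i3, i4, i5, i6, i7⟩ h5 h0 hF
    have hfa : τ.arr fa = σ.arr fa := by
      rw [hF.arr fa (by simp [Program.forLoop, Program.wArr, hSf.symm])]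
      simp [hSf.symm]
    have hwa : τ.rarr wa = σ.rarr wa := by
      rw [hF.rarr wa (by simp [Program.forLoop, Program.wRArr, hLw.symm])]
      simp
    have h3 : τ.arr 3 c = c * n := by
      rw [hF.arr 3 (by simp [Program.forLoop, Program.wArr, hS3.symm])]
      simpa [hS3.symm] using hM.offset c hbn
    have hb : τ.reg b = c := by
      rw [hF.reg b (by simp [Program.forLoop, Program.wReg, hb5])]
      simp [hc]
    have hcs : τ.arr S c = 2 := (i2 c hbn).2 (.inr rfl)
    have hLc : τ.rarr L c = σ.rarr L c := i3 c hbn hcs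
    refine .ite (fun ht => .seq (.setRArr (.setArr ?_))) (fun ht => .skip ?_)
    · simp only [Test.Holds, NatExpr.eval, RealExpr.eval, hfa, hwa, h3, hb, h5, hLc] at ht
      simp only [State.setReg_arr, State.setArr_arr, State.setRArr_arr, if_true, NatExpr.eval,
        RealExpr.eval, State.setRArr_reg, State.setReg_rarr, State.setArr_rarr, State.setRArr_rarr,
        hwa, h3, hb, h5, hLc]
      obtain ⟨ht1, ht2⟩ := ht
      rw [not_and_not_right] at ht2
      have he : A c i (σ.rarr wa (c * n + i)) := (hM.entry c hbn i hi _).2 ⟨by omega, rfl⟩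
      have hw0 := (hA _ _ _ he).2.2
      -- A settled label is at most that of `c`, so a non-negative edge cannot strictly improve it;
      -- no settled vertex is reopened.
      have hi2 : τ.arr S i ≠ 2 := by
        intro h
        have hlt := ht2 (by omega)
        rw [i3 i hi h] at hlt
        rcases (i2 i hi).1 h with h' | h'
        · have := hI.order i hi c hbn h' hb1
          linarith
        · subst h'; linarith
      refine ⟨by simp [Test.cost, NatExpr.cost, RealExpr.cost], fun x hx => ?_, fun x hx => ?_,
        fun x hx h => ?_, fun x hx h => ?_, fun x h => ?_, fun x hx h => ?_, fun y hy w h => ?_⟩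
      all_goals simp only [Function.update_apply] at *
      · have := i1 x hx
        split_ifs <;> omega
      · split_ifs with h
        · subst h; simpa [hi2] using i2 x hx
        · exact i2 x hx
      · split_ifs at h ⊢ with h'
        · exact absurd h (by norm_num)
        · exact i3 x hx h
      · split_ifs at h ⊢ with h'
        · subst h'; exact (hI.path c hbn (by omega)).snoc he
        · exact i4 x hx h
      · have h' := i5 x h
        split_ifs with hxi
        · subst hxi; exact ⟨by omega, by linarith [ht2 (by omega)]⟩
        · exact h'
      · split_ifs at h ⊢ with h'
        · linarith
        · exact i6 x hx h
      · split_ifs with h'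
        · subst h'
          rw [(hM.entry c hbn y hi w).1 h |>.2]
          simp
        · exact i7 y (by omega) w h
    · simp only [Test.Holds, NatExpr.eval, RealExpr.eval, hfa, hwa, h3, hb, h5, hLc] at ht
      refine ⟨by simp [Test.cost, NatExpr.cost, RealExpr.cost], i1, i2, i3, i4, i5, i6,
        fun y hy w h => ?_⟩
      rcases Nat.lt_succ_iff_lt_or_eq.1 hy with hy | rfl
      · exact i7 y hy w h
      · have he := (hM.entry c hbn y hi w).1 h
        rw [not_and, not_not, not_lt, he.2] at ht
        have := ht (Nat.pos_of_ne_zero he.1)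
        exact ⟨by simp only [State.setReg_arr]; omega, this.2⟩
  · rintro T σ' hF ⟨hT, i1, i2, i3, i4, i5, i6, i7⟩
    refine ⟨by simp only [NatExpr.cost]; omega, ⟨i1, (i5 r hI.root_seen).1,
      (i5 r hI.root_seen).2.trans hI.root_lab, i4, ?_, ?_⟩, i2, i3⟩
    · intro x hx h y w e
      rw [i3 x hx h]
      rcases (i2 x hx).1 h with h' | rfl
      · obtain ⟨q1, q2⟩ := hI.relax x hx h' y w e
        obtain ⟨q3, q4⟩ := i5 y q1
        exact ⟨q3, q4.trans q2⟩
      · exact i7 y (hA _ _ _ e).2.1 w e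
    · intro x hx y hy h h'
      rw [i3 x hx h]
      have := i6 y hy h'
      rcases (i2 x hx).1 h with h2 | rfl
      · exact (hI.order x hx c hbn h2 hb1).trans this
      · exact this

/-! ### Simultaneous backward and forward search -/

/-- The vertex `b` has the least tentative label; `b = n` if there is no tentative label. -/
def IsMinTentative (n : ℕ) (stat : ℕ → ℕ) (lab : ℕ → ℝ) (b : ℕ) : Prop :=
  (b = n ∧ ∀ x < n, stat x ≠ 1) ∨ (b < n ∧ stat b = 1 ∧ ∀ x < n, stat x = 1 → lab b ≤ lab x)

/-- The invariant of the simultaneous searches, backwards from `u` and forwards from `h`, after `r`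
vertices have been settled by each of them. -/
structure BiSearchInv (n : ℕ) (A : ℕ → ℕ → ℝ → Prop) (u h : ℕ) (w : ℝ) (sB : ℕ → ℕ) (lB : ℕ → ℝ)
    (sF : ℕ → ℕ) (lF : ℕ → ℝ) (r : ℕ) : Prop where
  backward : SearchInv n (fun x y w => A y x w) u sB lB
  forward : SearchInv n A h sF lF
  lt_zero : ∀ x < n, ∀ y < n, sB x = 2 → sF y = 2 → lB x + w + lF y < 0
  card_backward : ((Finset.range n).filter fun x => sB x = 2).card = r
  card_forward : ((Finset.range n).filter fun x => sF x = 2).card = r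

/-- The outcome of the simultaneous searches; `b` and `f` are the vertices with the least
tentative labels. -/
structure BiSearchResult (n : ℕ) (A : ℕ → ℕ → ℝ → Prop) (u h : ℕ) (w : ℝ) (sB : ℕ → ℕ) (lB : ℕ → ℝ)
    (sF : ℕ → ℕ) (lF : ℕ → ℝ) (b f r : ℕ) : Prop extends BiSearchInv n A u h w sB lB sF lF r where
  min_backward : IsMinTentative n sB lB b
  min_forward : IsMinTentative n sF lF f
  label_sum_nonneg : b < n → f < n → 0 ≤ lB b + w + lF f

/-- Each round settles a new backward vertex, and there are only `n`; this makes the search loop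
terminate. -/
theorem BiSearchInv.le {n : ℕ} {A : ℕ → ℕ → ℝ → Prop} {u h : ℕ} {w : ℝ} {sB : ℕ → ℕ} {lB : ℕ → ℝ}
    {sF : ℕ → ℕ} {lF : ℕ → ℝ} {r : ℕ} (H : BiSearchInv n A u h w sB lB sF lF r) : r ≤ n := by
  rw [← H.card_backward]
  exact (Finset.card_filter_le _ _).trans (by simp)

theorem card_settled_succ {n b : ℕ} {s s' : ℕ → ℕ} (hb : b < n) (hb1 : s b = 1)
    (h : ∀ x < n, s' x = 2 ↔ s x = 2 ∨ x = b) :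
    ((Finset.range n).filter fun x => s' x = 2).card =
      ((Finset.range n).filter fun x => s x = 2).card + 1 := by
  rw [← Finset.card_insert_of_notMem (a := b)]
  · congr 1
    ext x
    simp only [Finset.mem_filter, Finset.mem_range, Finset.mem_insert]
    constructor
    · rintro ⟨hx, h2⟩
      rcases (h x hx).1 h2 with h' | h'
      · exact .inr ⟨hx, h'⟩
      · exact .inl h'
    · rintro (rfl | ⟨hx, h2⟩)
      · exact ⟨hb, (h _ hb).2 (.inr rfl)⟩
      · exact ⟨hx, (h x hx).2 (.inl h2)⟩
  · simp [hb1]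

theorem HoldsMatrix.congr {σ τ : State} {n fa wa : ℕ} {A : ℕ → ℕ → ℝ → Prop}
    (h : HoldsMatrix σ n A fa wa) (h3 : τ.arr 3 = σ.arr 3) (hf : τ.arr fa = σ.arr fa)
    (hw : τ.rarr wa = σ.rarr wa) : HoldsMatrix τ n A fa wa := by
  constructor
  · rw [h3]; exact h.offset
  · rw [hf, hw]; exact h.entry

namespace Program
open NatExpr Test

/-- One round of the simultaneous searches. -/
def searchStep : Program :=
  seq (findMin 7 3 8) (seq (findMin 8 4 9)
    (ite (.and (natLt (.reg 8) (.reg 0)) (.and (natLt (.reg 9) (.reg 0))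
        (realLt (.add (.add (.get 3 (.reg 8)) (.reg 0)) (.get 4 (.reg 9))) .zero)))
      (seq (settle 7 3 5 2 8) (settle 8 4 4 1 9))
      (setReg 10 (.const 0))))

/-- Search backwards from the vertex in register `12` and forwards from the vertex in register
`13`, until the sum of the least tentative labels and of real register `0` is non-negative. -/
def search : Program :=
  seq (initSearch 7 3 12) (seq (initSearch 8 4 13) (seq (setReg 10 (.const 1))
    (loop (.natLt (.const 0) (.reg 10)) searchStep)))

end Program

section

variable {σ : State} {n : ℕ} {A : ℕ → ℕ → ℝ → Prop}

/-- The test that permits a round is what makes the newly settled pairs negative; its failure is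
exactly the information recorded in `BiSearchResult`. -/
theorem runs_searchStep {r u h : ℕ} (hn : σ.reg 0 = n) (hA : Bounded n A)
    (hF : HoldsMatrix σ n A 4 1) (hB : HoldsMatrix σ n (fun x y w => A y x w) 5 2)
    (hI : BiSearchInv n A u h (σ.rreg 0) (σ.arr 7) (σ.rarr 3) (σ.arr 8) (σ.rarr 4) r)
    (h10 : σ.reg 10 = 1) :
    Runs .searchStep σ fun T σ' => T ≤ 200 * n + 100 ∧
      ((σ'.reg 10 = 1 ∧
        BiSearchInv n A u h (σ.rreg 0) (σ'.arr 7) (σ'.rarr 3) (σ'.arr 8) (σ'.rarr 4) (r + 1)) ∨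
      (σ'.reg 10 = 0 ∧ BiSearchResult n A u h (σ.rreg 0) (σ'.arr 7) (σ'.rarr 3) (σ'.arr 8)
        (σ'.rarr 4) (σ'.reg 8) (σ'.reg 9) r)) := by
  refine .seq ((runs_findMin hn (by decide) (by decide)).mono fun T₁ σ₁ f₁ ⟨hT₁, hb⟩ => ?_)
  have e1 : σ₁.reg 0 = n := (f₁.reg 0 (by decide)).trans hn
  refine .seq ((runs_findMin e1 (by decide) (by decide)).mono fun T₂ σ₂ f₂ ⟨hT₂, hf⟩ => ?_)
  have e2 : σ₂.reg 0 = n := (f₂.reg 0 (by decide)).trans e1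
  have e8 : σ₂.reg 8 = σ₁.reg 8 := f₂.reg 8 (by decide)
  have e10 : σ₂.reg 10 = 1 := ((f₂.reg 10 (by decide)).trans (f₁.reg 10 (by decide))).trans h10
  have ea : ∀ a, σ₂.arr a = σ.arr a := fun a => by
    rw [f₂.arr a (by simp [Program.findMin, Program.forLoop, Program.wArr]),
      f₁.arr a (by simp [Program.findMin, Program.forLoop, Program.wArr])]
  have er : ∀ a, σ₂.rarr a = σ.rarr a := fun a => by
    rw [f₂.rarr a (by simp [Program.findMin, Program.forLoop, Program.wRArr]),
      f₁.rarr a (by simp [Program.findMin, Program.forLoop, Program.wRArr])]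
  have ew : σ₂.rreg 0 = σ.rreg 0 := (f₂.rreg 0 (by decide)).trans (f₁.rreg 0 (by decide))
  have eb : σ₁.arr 8 = σ.arr 8 := f₁.arr 8 (by decide)
  have el : σ₁.rarr 4 = σ.rarr 4 := f₁.rarr 4 (by decide)
  rw [← e8] at hb
  rw [eb, el] at hf
  refine .ite (fun ht => ?_) (fun ht => .setReg ?_)
  · simp only [Test.Holds, NatExpr.eval, RealExpr.eval, e2, er, ew] at ht
    obtain ⟨ht1, ht2, ht3⟩ := ht
    have hb' := hb.resolve_left fun h => ht1.ne h.1
    have hf' := hf.resolve_left fun h => ht2.ne h.1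
    refine .seq ((runs_settle (n := n) (r := u) (A := fun x y w => A y x w) e2
      (fun x y w h => ⟨(hA _ _ _ h).2.1, (hA _ _ _ h).1, (hA _ _ _ h).2.2⟩)
      (hB.congr (ea 3) (ea 5) (er 2)) (by rw [ea, er]; exact hI.backward) hb'.1
      (by rw [ea]; exact hb'.2.1) (by rw [ea, er]; exact hb'.2.2)
      (by decide) (by decide) (by decide) (by decide)).mono fun T₃ σ₃ f₃ ⟨hT₃, hB₃, hB₄, hB₅⟩ => ?_)
    have g0 : σ₃.reg 0 = n := (f₃.reg 0 (by decide)).trans e2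
    have g3 : σ₃.arr 3 = σ.arr 3 := (f₃.arr 3 (by decide)).trans (ea 3)
    have g4 : σ₃.arr 4 = σ.arr 4 := (f₃.arr 4 (by decide)).trans (ea 4)
    have g1 : σ₃.rarr 1 = σ.rarr 1 := (f₃.rarr 1 (by decide)).trans (er 1)
    have g8 : σ₃.arr 8 = σ.arr 8 := (f₃.arr 8 (by decide)).trans (ea 8)
    have gl : σ₃.rarr 4 = σ.rarr 4 := (f₃.rarr 4 (by decide)).trans (er 4)
    have g9 : σ₃.reg 9 = σ₂.reg 9 := f₃.reg 9 (by decide)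
    have g10 : σ₃.reg 10 = 1 := (f₃.reg 10 (by decide)).trans e10
    refine (runs_settle (n := n) (r := h) (A := A) g0 hA (hF.congr g3 g4 g1)
      (by rw [g8, gl]; exact hI.forward) (by rw [g9]; exact hf'.1)
      (by rw [g8, g9]; exact hf'.2.1) (by rw [g8, g9, gl]; exact hf'.2.2)
      (by decide) (by decide) (by decide) (by decide)).mono fun T₄ σ₄ f₄ ⟨hT₄, hF₃, hF₄, hF₅⟩ => ?_
    have k7 : σ₄.arr 7 = σ₃.arr 7 := f₄.arr 7 (by decide)
    have k3 : σ₄.rarr 3 = σ₃.rarr 3 := f₄.rarr 3 (by decide)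
    have k10 : σ₄.reg 10 = 1 := (f₄.reg 10 (by decide)).trans g10
    rw [ea, er] at *
    rw [g8, g9] at hF₄
    rw [gl] at hF₅
    refine ⟨?_, .inl ⟨k10, ?_⟩⟩
    · simp only [Test.cost, NatExpr.cost, RealExpr.cost]
      omega
    · refine ⟨by rw [k7, k3]; exact hB₃, hF₃, fun x hx y hy h2 h2' => ?_, ?_, ?_⟩
      · rw [k7] at h2
        rw [k3, hB₅ x hx h2, hF₅ y hy h2']
        -- The two minima dominate all labels settled so far, so the tested inequality for the
        -- minima bounds every new settled pair.
        have hle : σ.rarr 3 x ≤ σ.rarr 3 (σ₂.reg 8) := by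
          rcases (hB₄ x hx).1 h2 with h' | rfl
          · exact hI.backward.order x hx _ hb'.1 h' hb'.2.1
          · exact le_rfl
        have hle' : σ.rarr 4 y ≤ σ.rarr 4 (σ₂.reg 9) := by
          rcases (hF₄ y hy).1 h2' with h' | rfl
          · exact hI.forward.order y hy _ hf'.1 h' hf'.2.1
          · exact le_rfl
        linarith
      · rw [k7, card_settled_succ hb'.1 hb'.2.1 hB₄, hI.card_backward]
      · rw [card_settled_succ hf'.1 hf'.2.1 hF₄, hI.card_forward]
  · simp only [Test.Holds, NatExpr.eval, RealExpr.eval, e2, er, ew] at ht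
    refine ⟨?_, .inr ⟨by simp [NatExpr.eval], ?_⟩⟩
    · simp only [Test.cost, NatExpr.cost, RealExpr.cost]
      omega
    · simp only [State.setReg_arr, State.setReg_rarr, State.setReg_reg, ea, er]
      refine ⟨hI, hb, hf, fun h1 h2 => ?_⟩
      by_contra hlt
      exact ht ⟨h1, h2, not_le.1 hlt⟩

theorem runs_search (hn : σ.reg 0 = n) (hA : Bounded n A)
    (hF : HoldsMatrix σ n A 4 1) (hB : HoldsMatrix σ n (fun x y w => A y x w) 5 2)
    (hu : σ.reg 12 < n) (hh : σ.reg 13 < n) :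
    Runs .search σ fun T σ' => ∃ r, T ≤ 300 * (n + 1) * (r + 1) ∧
      BiSearchResult n A (σ.reg 12) (σ.reg 13) (σ.rreg 0) (σ'.arr 7) (σ'.rarr 3) (σ'.arr 8)
        (σ'.rarr 4) (σ'.reg 8) (σ'.reg 9) r := by
  refine .seq ((runs_initSearch hn hu (by decide) (fun x y w => A y x w)).mono
    fun T₁ σ₁ f₁ ⟨hT₁, hs₁, hI₁⟩ => ?_)
  have a0 : σ₁.reg 0 = n := (f₁.reg 0 (by decide)).trans hn
  have a13 : σ₁.reg 13 = σ.reg 13 := f₁.reg 13 (by decide)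
  refine .seq ((runs_initSearch a0 (by rw [a13]; exact hh) (by decide) A).mono
    fun T₂ σ₂ f₂ ⟨hT₂, hs₂, hI₂⟩ => .seq (.setReg ?_))
  rw [a13] at hs₂ hI₂
  have b0 : σ₂.reg 0 = n := (f₂.reg 0 (by decide)).trans a0
  have b7 : σ₂.arr 7 = σ₁.arr 7 := f₂.arr 7 (by decide)
  have bl : σ₂.rarr 3 = σ₁.rarr 3 := f₂.rarr 3 (by decide)
  have bw : σ₂.rreg 0 = σ.rreg 0 := (f₂.rreg 0 (by decide)).trans (f₁.rreg 0 (by decide))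
  -- The count `i` includes the last round, which settles nothing and clears the flag in register
  -- `10`; hence `i = r + 1` at the end and the bound `n + 1`. The summand 3 in `103` pays for the
  -- loop test.
  refine (Runs.loop (n + 1) (fun i T τ => T ≤ (200 * n + 103) * i ∧
    ((τ.reg 10 = 1 ∧ BiSearchInv n A (σ.reg 12) (σ.reg 13) (σ.rreg 0) (τ.arr 7) (τ.rarr 3)
      (τ.arr 8) (τ.rarr 4) i) ∨
    (τ.reg 10 = 0 ∧ ∃ r, i = r + 1 ∧ BiSearchResult n A (σ.reg 12) (σ.reg 13) (σ.rreg 0)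
      (τ.arr 7) (τ.rarr 3) (τ.arr 8) (τ.rarr 4) (τ.reg 8) (τ.reg 9) r))) ?_ ?_).mono ?_
  · refine ⟨by simp, .inl ⟨by simp [NatExpr.eval], ?_⟩⟩
    simp only [State.setReg_arr, State.setReg_rarr, b7, bl]
    refine ⟨hI₁, hI₂, fun x hx y hy h => ?_, ?_, ?_⟩
    · rw [hs₁ x hx] at h; split at h <;> omega
    · rw [Finset.card_eq_zero, Finset.filter_eq_empty_iff]
      intro x hx h
      rw [hs₁ x (Finset.mem_range.1 hx)] at h; split at h <;> omega
    · rw [Finset.card_eq_zero, Finset.filter_eq_empty_iff]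
      intro x hx h
      rw [hs₂ x (Finset.mem_range.1 hx)] at h; split at h <;> omega
  · rintro i T τ ⟨hT, hI⟩ ht hf
    simp only [Test.Holds, NatExpr.eval] at ht
    rcases hI with ⟨h10, hI⟩ | ⟨h10, -⟩
    swap
    · omega
    have hle := hI.le
    have c0 : τ.reg 0 = n := by rw [hf.reg 0 (by decide)]; simpa using b0
    have cw : τ.rreg 0 = σ.rreg 0 := by rw [hf.rreg 0 (by decide)]; exact bw
    have c3 : τ.arr 3 = σ.arr 3 :=
      (hf.arr 3 (by decide)).trans ((f₂.arr 3 (by decide)).trans (f₁.arr 3 (by decide)))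
    have c4 : τ.arr 4 = σ.arr 4 :=
      (hf.arr 4 (by decide)).trans ((f₂.arr 4 (by decide)).trans (f₁.arr 4 (by decide)))
    have c5 : τ.arr 5 = σ.arr 5 :=
      (hf.arr 5 (by decide)).trans ((f₂.arr 5 (by decide)).trans (f₁.arr 5 (by decide)))
    have c1 : τ.rarr 1 = σ.rarr 1 :=
      (hf.rarr 1 (by decide)).trans ((f₂.rarr 1 (by decide)).trans (f₁.rarr 1 (by decide)))
    have c2 : τ.rarr 2 = σ.rarr 2 :=
      (hf.rarr 2 (by decide)).trans ((f₂.rarr 2 (by decide)).trans (f₁.rarr 2 (by decide)))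
    rw [← cw] at hI
    refine ⟨by omega, (runs_searchStep c0 hA (hF.congr c3 c4 c1) (hB.congr c3 c5 c2) hI h10).mono
      fun T' τ' _ ⟨hT', h'⟩ => ⟨?_, ?_⟩⟩
    · simp only [Test.cost, NatExpr.cost, mul_add]
      omega
    · rw [cw] at h'
      rcases h' with h' | ⟨h0, h'⟩
      · exact .inl h'
      · exact .inr ⟨h0, i, rfl, h'⟩
  · rintro T σ' - ⟨i, T', hT, ⟨hT', hI⟩, hn⟩
    simp only [Test.Holds, NatExpr.eval] at hn
    rcases hI with ⟨h10, -⟩ | ⟨-, r, rfl, hI⟩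
    · omega
    · refine ⟨r, ?_, hI⟩
      simp only [NatExpr.cost, Test.cost] at hT ⊢
      nlinarith [Nat.zero_le (n * r)]

end

/-! ### Writing the new edges -/

section

variable {n m : ℕ}

/-- The memory holds the edges of `G`, followed by the new edges `L` (source, target, weight). -/
structure Output (σ : State) (G : FrozenGraph (Fin n) (Fin m)) (L : List (ℕ × ℕ × ℝ)) : Prop where
  count : σ.reg 1 = m + L.length
  src : ∀ e : Fin m, σ.arr 0 e = (G.src e : ℕ)
  tgt : ∀ e : Fin m, σ.arr 1 e = (G.tgt e : ℕ)
  neg : ∀ e : Fin m, σ.arr 2 e = if G.neg e = true then 1 else 0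
  weight : ∀ e : Fin m, σ.rarr 0 e = G.weight e
  new_src : ∀ i (hi : i < L.length), σ.arr 0 (m + i) = L[i].1
  new_tgt : ∀ i (hi : i < L.length), σ.arr 1 (m + i) = L[i].2.1
  new_weight : ∀ i (hi : i < L.length), σ.rarr 0 (m + i) = L[i].2.2
  new_neg : ∀ i (hi : i < L.length), σ.arr 2 (m + i) = if L[i].2.2 < 0 then 1 else 0

theorem Output.congr {σ τ : State} {G : FrozenGraph (Fin n) (Fin m)} {L : List (ℕ × ℕ × ℝ)}
    (h : Output σ G L) (h1 : τ.reg 1 = σ.reg 1) (a0 : τ.arr 0 = σ.arr 0) (a1 : τ.arr 1 = σ.arr 1)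
    (a2 : τ.arr 2 = σ.arr 2) (r0 : τ.rarr 0 = σ.rarr 0) : Output τ G L := by
  constructor <;> simp only [h1, a0, a1, a2, r0]
  exacts [h.count, h.src, h.tgt, h.neg, h.weight, h.new_src, h.new_tgt, h.new_weight, h.new_neg]

theorem Output.setReg {σ : State} {G : FrozenGraph (Fin n) (Fin m)} {L : List (ℕ × ℕ × ℝ)}
    {x v : ℕ} (h : Output σ G L) (hx : x ≠ 1) : Output (σ.setReg x v) G L :=
  h.congr (by simp [hx.symm]) rfl rfl rfl rfl

theorem Output.setRReg {σ : State} {G : FrozenGraph (Fin n) (Fin m)} {L : List (ℕ × ℕ × ℝ)}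
    {x : ℕ} {v : ℝ} (h : Output σ G L) : Output (σ.setRReg x v) G L :=
  h.congr rfl rfl rfl rfl rfl

/-- The numbers `q 0, …, q (k - 1)` enumerate the negative edges of `G`, with sources `us`, targets
`hs` and weights `ws`. -/
structure NegEnum (G : FrozenGraph (Fin n) (Fin m)) (k : ℕ) (q us hs : ℕ → ℕ) (ws : ℕ → ℝ) :
    Prop where
  spec : ∀ i < k, ∃ e : Fin m, q i = e ∧ G.neg e = true ∧ us i = G.src e ∧ hs i = G.tgt e ∧
    ws i = G.weight e
  inj : ∀ i < k, ∀ j < k, q i = q j → i = j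
  surj : ∀ e : Fin m, G.neg e = true → ∃ i < k, q i = e

/-- The edges that merge the negative edge from `u` to `h` of weight `w` with the `i`-th one. -/
def mergeEdges (us hs : ℕ → ℕ) (ws : ℕ → ℝ) (u h : ℕ) (w : ℝ) (sB : ℕ → ℕ) (lB : ℕ → ℝ)
    (sF : ℕ → ℕ) (lF : ℕ → ℝ) (i : ℕ) : List (ℕ × ℕ × ℝ) :=
  (if 1 < sB (hs i) then [(us i, h, ws i + lB (hs i) + w)] else []) ++
    (if 1 < sF (us i) then [(u, hs i, w + lF (us i) + ws i)] else [])

/-- The edges between `x` and the Steiner vertex `z`. -/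
def steinerEdges (z b : ℕ) (w : ℝ) (sB : ℕ → ℕ) (lB : ℕ → ℝ) (sF : ℕ → ℕ) (lF : ℕ → ℝ) (x : ℕ) :
    List (ℕ × ℕ × ℝ) :=
  (if sB x = 1 then [(x, z, lB x - lB b)] else []) ++
    (if sF x = 1 then [(z, x, w + lF x + lB b)] else [])

/-- The new edges for the negative edge from `u` to `h` of weight `w` with Steiner vertex `z`. -/
def blockEdges (n k : ℕ) (us hs : ℕ → ℕ) (ws : ℕ → ℝ) (u h z : ℕ) (w : ℝ) (sB : ℕ → ℕ) (lB : ℕ → ℝ)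
    (sF : ℕ → ℕ) (lF : ℕ → ℝ) (b f : ℕ) : List (ℕ × ℕ × ℝ) :=
  (List.range k).flatMap (mergeEdges us hs ws u h w sB lB sF lF) ++
    if b < n ∧ f < n then (List.range n).flatMap (steinerEdges z b w sB lB sF lF) else []

end

namespace Program
open NatExpr Test

/-- Append the edge from register `14` to register `15` of weight real register `2`. -/
def emit : Program :=
  seq (setArr 0 (.reg 1) (.reg 14)) (seq (setArr 1 (.reg 1) (.reg 15))
    (seq (setRArr 0 (.reg 1) (.reg 2)) (seq
      (ite (realLt (.reg 2) .zero) (setArr 2 (.reg 1) (.const 1)) (setArr 2 (.reg 1) (.const 0)))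
      (setReg 1 (.add (.reg 1) (.const 1))))))

/-- Append the edges that merge the current negative edge with the one of index register `6`. -/
def mergeStep : Program :=
  seq (setReg 16 (.get 0 (.get 6 (.reg 6)))) (seq (setReg 17 (.get 1 (.get 6 (.reg 6))))
    (seq (setRReg 3 (.get 0 (.get 6 (.reg 6)))) (seq
      (ite (natLt (.const 1) (.get 7 (.reg 17)))
        (seq (setReg 14 (.reg 16)) (seq (setReg 15 (.reg 13))
          (seq (setRReg 2 (.add (.add (.reg 3) (.get 3 (.reg 17))) (.reg 0))) emit))) skip)
      (ite (natLt (.const 1) (.get 8 (.reg 16)))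
        (seq (setReg 14 (.reg 12)) (seq (setReg 15 (.reg 17))
          (seq (setRReg 2 (.add (.add (.reg 0) (.get 4 (.reg 16))) (.reg 3))) emit))) skip))))

/-- Append the edges between the vertex in register `5` and the current Steiner vertex. -/
def steinerStep : Program :=
  seq (ite (.and (natLt (.const 0) (.get 7 (.reg 5))) (natLt (.get 7 (.reg 5)) (.const 2)))
      (seq (setReg 14 (.reg 5)) (seq (setReg 15 (.add (.reg 0) (.reg 11)))
        (seq (setRReg 2 (.sub (.get 3 (.reg 5)) (.get 3 (.reg 8)))) emit))) skip)
    (ite (.and (natLt (.const 0) (.get 8 (.reg 5))) (natLt (.get 8 (.reg 5)) (.const 2)))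
      (seq (setReg 14 (.add (.reg 0) (.reg 11))) (seq (setReg 15 (.reg 5))
        (seq (setRReg 2 (.add (.add (.reg 0) (.get 4 (.reg 5))) (.get 3 (.reg 8)))) emit))) skip)

/-- Search around the negative edge of index register `11`, and append the new edges for it. -/
def process : Program :=
  seq (setReg 12 (.get 0 (.get 6 (.reg 11)))) (seq (setReg 13 (.get 1 (.get 6 (.reg 11))))
    (seq (setRReg 0 (.get 0 (.get 6 (.reg 11)))) (seq search (seq (forLoop 6 2 mergeStep)
      (ite (.and (natLt (.reg 8) (.reg 0)) (natLt (.reg 9) (.reg 0)))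
        (forLoop 5 0 steinerStep) skip)))))

end Program

section

variable {n m k : ℕ} {σ : State} {G : FrozenGraph (Fin n) (Fin m)} {L : List (ℕ × ℕ × ℝ)}

theorem runs_emit (h : Output σ G L) :
    Runs .emit σ fun T σ' => T ≤ 20 ∧
      Output σ' G (L ++ [(σ.reg 14, σ.reg 15, σ.rreg 2)]) := by
  -- Stated for an arbitrary marking `v`, so that both branches of the sign test can use it.
  have key : ∀ v, v = (if σ.rreg 2 < 0 then 1 else 0) → ∀ τ : State,
      τ.reg 1 = σ.reg 1 + 1 → τ.arr 0 = Function.update (σ.arr 0) (σ.reg 1) (σ.reg 14) →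
      τ.arr 1 = Function.update (σ.arr 1) (σ.reg 1) (σ.reg 15) →
      τ.arr 2 = Function.update (σ.arr 2) (σ.reg 1) v →
      τ.rarr 0 = Function.update (σ.rarr 0) (σ.reg 1) (σ.rreg 2) →
      Output τ G (L ++ [(σ.reg 14, σ.reg 15, σ.rreg 2)]) := by
    rintro v hv τ h1 a0 a1 a2 r0
    have hne : ∀ e : Fin m, (e : ℕ) ≠ m + L.length := fun e => by omega
    constructor <;> simp only [h1, a0, a1, a2, r0, h.count]
    · simp [add_assoc]
    · intro e; rw [Function.update_of_ne (hne e), h.src]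
    · intro e; rw [Function.update_of_ne (hne e), h.tgt]
    · intro e; rw [Function.update_of_ne (hne e), h.neg]
    · intro e; rw [Function.update_of_ne (hne e), h.weight]
    all_goals
      intro i hi
      rw [List.length_append, List.length_singleton, Nat.lt_succ_iff_lt_or_eq] at hi
      rcases hi with hi | rfl
      · rw [Function.update_of_ne (by omega)]
        simp only [List.getElem_append_left hi]
        first
          | exact h.new_src i hi
          | exact h.new_tgt i hi
          | exact h.new_weight i hi
          | exact h.new_neg i hi
      · simp [hv]
  refine .seq (.setArr (.seq (.setArr (.seq (.setRArr (.seq (.ite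
    (fun ht => .setArr (.setReg ?_)) (fun ht => .setArr (.setReg ?_)))))))))
  all_goals
    simp only [Test.Holds, RealExpr.eval, State.setRArr_rreg, State.setArr_rreg] at ht
    refine ⟨by simp [NatExpr.cost, RealExpr.cost, Test.cost],
      key _ (by simp only [ht, if_true, if_false]; rfl) _ ?_ ?_ ?_ ?_ ?_⟩
    all_goals simp [NatExpr.eval, RealExpr.eval]

theorem runs_mergeStep {us hs : ℕ → ℕ} {ws : ℕ → ℝ} (hout : Output σ G L)
    (hq : NegEnum G k (σ.arr 6) us hs ws) (hi : σ.reg 6 < k) :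
    Runs .mergeStep σ fun T σ' => T ≤ 100 ∧
      Output σ' G (L ++ mergeEdges us hs ws (σ.reg 12) (σ.reg 13) (σ.rreg 0) (σ.arr 7) (σ.rarr 3)
        (σ.arr 8) (σ.rarr 4) (σ.reg 6)) := by
  obtain ⟨e, he, -, hu, hh, hw⟩ := hq.spec _ hi
  have gu := hout.src e
  have gh := hout.tgt e
  have gw := hout.weight e
  rw [← he] at gu gh gw
  rw [← hu] at gu
  rw [← hh] at gh
  rw [← hw] at gw
  refine .seq (.setReg (.seq (.setReg (.seq (.setRReg (.seq ?_))))))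
  set σ₁ := (((σ.setReg 16 (NatExpr.eval σ (.get 0 (.get 6 (.reg 6))))).setReg 17 _).setRReg 3 _)
    with hσ₁
  have o1 : Output σ₁ G L := hout.congr (by simp [hσ₁]) rfl rfl rfl rfl
  have e16 : σ₁.reg 16 = us (σ.reg 6) := by simp [hσ₁, NatExpr.eval, gu]
  have e17 : σ₁.reg 17 = hs (σ.reg 6) := by simp [hσ₁, NatExpr.eval, gh]
  have e3 : σ₁.rreg 3 = ws (σ.reg 6) := by simp [hσ₁, NatExpr.eval, RealExpr.eval, gw]
  have e12 : σ₁.reg 12 = σ.reg 12 := by simp [hσ₁]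
  have e13 : σ₁.reg 13 = σ.reg 13 := by simp [hσ₁]
  have e0 : σ₁.rreg 0 = σ.rreg 0 := by simp [hσ₁]
  have ea : σ₁.arr = σ.arr := rfl
  have er : σ₁.rarr = σ.rarr := rfl
  clear_value σ₁
  have first : Runs (.ite (.natLt (.const 1) (.get 7 (.reg 17)))
        (.seq (.setReg 14 (.reg 16)) (.seq (.setReg 15 (.reg 13))
          (.seq (.setRReg 2 (.add (.add (.reg 3) (.get 3 (.reg 17))) (.reg 0))) .emit))) .skip) σ₁
      fun T σ' => T ≤ 35 ∧ Output σ' G (L ++ if 1 < σ.arr 7 (hs (σ.reg 6)) then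
        [(us (σ.reg 6), σ.reg 13, ws (σ.reg 6) + σ.rarr 3 (hs (σ.reg 6)) + σ.rreg 0)] else []) := by
    refine .ite (fun ht => .seq (.setReg (.seq (.setReg (.seq (.setRReg ?_)))))) (fun ht => .skip ?_)
    · refine (runs_emit ((o1.setReg (by decide)).setReg (by decide)).setRReg).mono fun T σ' _ ⟨hT, ho⟩ => ⟨?_, ?_⟩
      · simp only [NatExpr.cost, RealExpr.cost, Test.cost]; omega
      · simp only [Test.Holds, NatExpr.eval, e17, ea] at ht
        simpa [NatExpr.eval, RealExpr.eval, e16, e17, e3, e13, e0, ea, er, ht] using ho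
    · simp only [Test.Holds, NatExpr.eval, e17, ea] at ht
      exact ⟨by simp [NatExpr.cost, Test.cost], by simpa [ht] using o1⟩
  refine first.mono fun T₁ σ₂ f ⟨hT₁, o2⟩ => ?_
  have k16 : σ₂.reg 16 = us (σ.reg 6) := (f.reg 16 (by decide)).trans e16
  have k17 : σ₂.reg 17 = hs (σ.reg 6) := (f.reg 17 (by decide)).trans e17
  have k3 : σ₂.rreg 3 = ws (σ.reg 6) := (f.rreg 3 (by decide)).trans e3
  have k12 : σ₂.reg 12 = σ.reg 12 := (f.reg 12 (by decide)).trans e12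
  have k0 : σ₂.rreg 0 = σ.rreg 0 := (f.rreg 0 (by decide)).trans e0
  have k8 : σ₂.arr 8 = σ.arr 8 := (f.arr 8 (by decide)).trans (by rw [ea])
  have k4 : σ₂.rarr 4 = σ.rarr 4 := (f.rarr 4 (by decide)).trans (by rw [er])
  rw [mergeEdges, ← List.append_assoc]
  refine .ite (fun ht => .seq (.setReg (.seq (.setReg (.seq (.setRReg ?_)))))) (fun ht => .skip ?_)
  · refine (runs_emit ((o2.setReg (by decide)).setReg (by decide)).setRReg).mono fun T σ' _ ⟨hT, ho⟩ => ⟨?_, ?_⟩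
    · simp only [NatExpr.cost, RealExpr.cost, Test.cost]; omega
    · simp only [Test.Holds, NatExpr.eval, k16, k8] at ht
      simpa [NatExpr.eval, RealExpr.eval, k16, k17, k3, k12, k0, k8, k4, ht] using ho
  · simp only [Test.Holds, NatExpr.eval, k16, k8] at ht
    exact ⟨by simp only [NatExpr.cost, RealExpr.cost, Test.cost]; omega, by simpa [ht] using o2⟩

theorem runs_steinerStep (hout : Output σ G L) (h2 : σ.arr 7 (σ.reg 5) ≤ 2)
    (h2' : σ.arr 8 (σ.reg 5) ≤ 2) :
    Runs .steinerStep σ fun T σ' => T ≤ 90 ∧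
      Output σ' G (L ++ steinerEdges (σ.reg 0 + σ.reg 11) (σ.reg 8) (σ.rreg 0) (σ.arr 7) (σ.rarr 3)
        (σ.arr 8) (σ.rarr 4) (σ.reg 5)) := by
  have first : Runs (.ite (.and (.natLt (.const 0) (.get 7 (.reg 5)))
        (.natLt (.get 7 (.reg 5)) (.const 2)))
      (.seq (.setReg 14 (.reg 5)) (.seq (.setReg 15 (.add (.reg 0) (.reg 11)))
        (.seq (.setRReg 2 (.sub (.get 3 (.reg 5)) (.get 3 (.reg 8)))) .emit))) .skip) σ
      fun T σ' => T ≤ 45 ∧ Output σ' G (L ++ if σ.arr 7 (σ.reg 5) = 1 then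
        [(σ.reg 5, σ.reg 0 + σ.reg 11, σ.rarr 3 (σ.reg 5) - σ.rarr 3 (σ.reg 8))] else []) := by
    refine .ite (fun ht => .seq (.setReg (.seq (.setReg (.seq (.setRReg ?_)))))) (fun ht => .skip ?_)
    · refine (runs_emit ((hout.setReg (by decide)).setReg (by decide)).setRReg).mono fun T σ' _ ⟨hT, ho⟩ => ⟨?_, ?_⟩
      · simp only [NatExpr.cost, RealExpr.cost, Test.cost]; omega
      · simp only [Test.Holds, NatExpr.eval] at ht
        have h1 : σ.arr 7 (σ.reg 5) = 1 := by omega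
        simpa [NatExpr.eval, RealExpr.eval, h1] using ho
    · simp only [Test.Holds, NatExpr.eval] at ht
      have h1 : σ.arr 7 (σ.reg 5) ≠ 1 := by omega
      exact ⟨by simp [NatExpr.cost, Test.cost], by simpa [h1] using hout⟩
  refine .seq (first.mono fun T₁ σ₂ f ⟨hT₁, o2⟩ => ?_)
  have k0 : σ₂.reg 0 = σ.reg 0 := f.reg 0 (by decide)
  have k11 : σ₂.reg 11 = σ.reg 11 := f.reg 11 (by decide)
  have k5 : σ₂.reg 5 = σ.reg 5 := f.reg 5 (by decide)
  have k8 : σ₂.reg 8 = σ.reg 8 := f.reg 8 (by decide)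
  have w0 : σ₂.rreg 0 = σ.rreg 0 := f.rreg 0 (by decide)
  have a8 : σ₂.arr 8 = σ.arr 8 := f.arr 8 (by decide)
  have r4 : σ₂.rarr 4 = σ.rarr 4 := f.rarr 4 (by decide)
  have r3 : σ₂.rarr 3 = σ.rarr 3 := f.rarr 3 (by decide)
  rw [steinerEdges, ← List.append_assoc]
  refine .ite (fun ht => .seq (.setReg (.seq (.setReg (.seq (.setRReg ?_)))))) (fun ht => .skip ?_)
  · refine (runs_emit ((o2.setReg (by decide)).setReg (by decide)).setRReg).mono fun T σ' _ ⟨hT, ho⟩ => ⟨?_, ?_⟩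
    · simp only [NatExpr.cost, RealExpr.cost, Test.cost]; omega
    · simp only [Test.Holds, NatExpr.eval, k5, a8] at ht
      have h1 : σ.arr 8 (σ.reg 5) = 1 := by omega
      simpa [NatExpr.eval, RealExpr.eval, h1, k0, k11, k5, k8, w0, r4, r3] using ho
  · simp only [Test.Holds, NatExpr.eval, k5, a8] at ht
    have h1 : σ.arr 8 (σ.reg 5) ≠ 1 := by omega
    exact ⟨by simp only [NatExpr.cost, Test.cost]; omega, by simpa [h1] using o2⟩

/-- The new edges for the `j`-th negative edge, computed by searches with `r` rounds. -/
def IsBlock (n k : ℕ) (A : ℕ → ℕ → ℝ → Prop) (us hs : ℕ → ℕ) (ws : ℕ → ℝ) (j : ℕ)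
    (l : List (ℕ × ℕ × ℝ)) (r : ℕ) : Prop :=
  ∃ sB lB sF lF b f, BiSearchResult n A (us j) (hs j) (ws j) sB lB sF lF b f r ∧
    l = blockEdges n k us hs ws (us j) (hs j) (n + j) (ws j) sB lB sF lF b f

theorem runs_process {us hs : ℕ → ℕ} {ws : ℕ → ℝ} {A : ℕ → ℕ → ℝ → Prop} (hout : Output σ G L)
    (hn : σ.reg 0 = n) (hk : σ.reg 2 = k) (hkn : k ≤ n) (hA : Bounded n A)
    (hF : HoldsMatrix σ n A 4 1) (hB : HoldsMatrix σ n (fun x y w => A y x w) 5 2)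
    (hq : NegEnum G k (σ.arr 6) us hs ws) (hj : σ.reg 11 < k) :
    Runs .process σ fun T σ' => ∃ l r, T ≤ 600 * (n + 1) * (r + 1) ∧
      IsBlock n k A us hs ws (σ.reg 11) l r ∧ Output σ' G (L ++ l) := by
  obtain ⟨e, he, -, hu, hh, hw⟩ := hq.spec _ hj
  have gu := hout.src e
  have gh := hout.tgt e
  have gw := hout.weight e
  rw [← he, ← hu] at gu
  rw [← he, ← hh] at gh
  rw [← he, ← hw] at gw
  refine .seq (.setReg (.seq (.setReg (.seq (.setRReg (.seq ?_))))))
  set σ₁ := (((σ.setReg 12 (NatExpr.eval σ (.get 0 (.get 6 (.reg 11))))).setReg 13 _).setRReg 0 _)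
    with hσ₁
  have o1 : Output σ₁ G L := hout.congr (by simp [hσ₁]) rfl rfl rfl rfl
  have e12 : σ₁.reg 12 = us (σ.reg 11) := by simp [hσ₁, NatExpr.eval, gu]
  have e13 : σ₁.reg 13 = hs (σ.reg 11) := by simp [hσ₁, NatExpr.eval, gh]
  have ew : σ₁.rreg 0 = ws (σ.reg 11) := by simp [hσ₁, NatExpr.eval, RealExpr.eval, gw]
  have e0 : σ₁.reg 0 = n := by simp [hσ₁, hn]
  have e2 : σ₁.reg 2 = k := by simp [hσ₁, hk]
  have e11 : σ₁.reg 11 = σ.reg 11 := by simp [hσ₁]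
  have ea : σ₁.arr = σ.arr := rfl
  have er : σ₁.rarr = σ.rarr := rfl
  clear_value σ₁
  refine (runs_search e0 hA (hF.congr (by rw [ea]) (by rw [ea]) (by rw [er]))
    (hB.congr (by rw [ea]) (by rw [ea]) (by rw [er])) (by rw [e12, hu]; exact (G.src e).2)
    (by rw [e13, hh]; exact (G.tgt e).2)).mono fun T₁ σ₂ f₂ ⟨r, hT₁, hres⟩ => ?_
  have o2 : Output σ₂ G L := o1.congr (f₂.reg 1 (by decide)) (f₂.arr 0 (by decide))
    (f₂.arr 1 (by decide)) (f₂.arr 2 (by decide)) (f₂.rarr 0 (by decide))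
  rw [e12, e13, ew] at hres
  have k12 : σ₂.reg 12 = us (σ.reg 11) := (f₂.reg 12 (by decide)).trans e12
  have k13 : σ₂.reg 13 = hs (σ.reg 11) := (f₂.reg 13 (by decide)).trans e13
  have kw : σ₂.rreg 0 = ws (σ.reg 11) := (f₂.rreg 0 (by decide)).trans ew
  have k0 : σ₂.reg 0 = n := (f₂.reg 0 (by decide)).trans e0
  have k2 : σ₂.reg 2 = k := (f₂.reg 2 (by decide)).trans e2
  have k11 : σ₂.reg 11 = σ.reg 11 := (f₂.reg 11 (by decide)).trans e11
  have k6 : σ₂.arr 6 = σ.arr 6 := (f₂.arr 6 (by decide)).trans (by rw [ea])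
  refine .seq ((Runs.forLoop_le (N := k) 100 (fun i τ => Output τ G (L ++ (List.range i).flatMap
    (mergeEdges us hs ws (us (σ.reg 11)) (hs (σ.reg 11)) (ws (σ.reg 11)) (σ₂.arr 7) (σ₂.rarr 3)
      (σ₂.arr 8) (σ₂.rarr 4)))) (by decide) (by decide) (by decide) k2 ?_ ?_).mono
    fun T₃ σ₃ f₃ ⟨hT₃, o3⟩ => ?_)
  · simpa using o2.setReg (x := 6) (v := 0) (by decide)
  · intro i τ hi hI hi6 _ f
    refine (runs_mergeStep (k := k) (us := us) (hs := hs) (ws := ws) hI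
      (by rw [f.arr 6 (by decide), k6]; exact hq) (by omega)).mono fun T τ' _ ⟨hT, ho⟩ => ⟨hT, ?_⟩
    rw [f.reg 12 (by decide), f.reg 13 (by decide), f.rreg 0 (by decide), f.arr 7 (by decide),
      f.rarr 3 (by decide), f.arr 8 (by decide), f.rarr 4 (by decide), k12, k13, kw, hi6] at ho
    rw [List.range_succ, List.flatMap_append, List.flatMap_singleton, ← List.append_assoc]
    exact ho.setReg (by decide)
  have l8 : σ₃.reg 8 = σ₂.reg 8 := f₃.reg 8 (by decide)
  have l9 : σ₃.reg 9 = σ₂.reg 9 := f₃.reg 9 (by decide)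
  have l0 : σ₃.reg 0 = n := (f₃.reg 0 (by decide)).trans k0
  -- Writing the edges takes `O(k + n)` steps with `k ≤ n`; this is charged to the slack between the
  -- constants 300 of the searches and 600.
  have hmul : n + 1 ≤ (n + 1) * (r + 1) := Nat.le_mul_of_pos_right _ (by omega)
  rw [mul_assoc] at hT₁
  refine .ite (fun ht => ?_) (fun ht => .skip ?_)
  · simp only [Test.Holds, NatExpr.eval, l8, l9, l0] at ht
    refine (Runs.forLoop_le (N := n) 90 (fun i τ => Output τ G ((L ++ (List.range k).flatMap
      (mergeEdges us hs ws (us (σ.reg 11)) (hs (σ.reg 11)) (ws (σ.reg 11)) (σ₂.arr 7) (σ₂.rarr 3)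
      (σ₂.arr 8) (σ₂.rarr 4))) ++ (List.range i).flatMap
        (steinerEdges (n + σ.reg 11) (σ₂.reg 8) (ws (σ.reg 11)) (σ₂.arr 7) (σ₂.rarr 3)
      (σ₂.arr 8) (σ₂.rarr 4)))) (by decide) (by decide) (by decide) l0 ?_ ?_).mono
      fun T₄ σ₄ f₄ ⟨hT₄, o4⟩ => ?_
    · simpa using o3.setReg (x := 5) (v := 0) (by decide)
    · intro i τ hi hI hi5 hi0 f
      have g7 : τ.arr 7 = σ₂.arr 7 := (f.arr 7 (by decide)).trans (f₃.arr 7 (by decide))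
      have g8 : τ.arr 8 = σ₂.arr 8 := (f.arr 8 (by decide)).trans (f₃.arr 8 (by decide))
      have g3 : τ.rarr 3 = σ₂.rarr 3 := (f.rarr 3 (by decide)).trans (f₃.rarr 3 (by decide))
      have g4 : τ.rarr 4 = σ₂.rarr 4 := (f.rarr 4 (by decide)).trans (f₃.rarr 4 (by decide))
      have gb : τ.reg 8 = σ₂.reg 8 := (f.reg 8 (by decide)).trans l8
      have g11 : τ.reg 11 = σ.reg 11 :=
        ((f.reg 11 (by decide)).trans (f₃.reg 11 (by decide))).trans k11
      have gw' : τ.rreg 0 = ws (σ.reg 11) :=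
        ((f.rreg 0 (by decide)).trans (f₃.rreg 0 (by decide))).trans kw
      refine (runs_steinerStep hI (by rw [g7, hi5]; exact hres.backward.le_two i hi)
        (by rw [g8, hi5]; exact hres.forward.le_two i hi)).mono fun T τ' _ ⟨hT, ho⟩ => ⟨hT, ?_⟩
      rw [g7, g8, g3, g4, gb, g11, gw', hi5, hi0] at ho
      rw [List.range_succ, List.flatMap_append, List.flatMap_singleton, ← List.append_assoc]
      exact ho.setReg (by decide)
    · refine ⟨_, r, ?_, ⟨_, _, _, _, _, _, hres, rfl⟩, ?_⟩
      · simp only [NatExpr.cost, RealExpr.cost, Test.cost, mul_assoc]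
        omega
      · rw [blockEdges, if_pos ht, ← List.append_assoc]
        exact o4
  · simp only [Test.Holds, NatExpr.eval, l8, l9, l0] at ht
    refine ⟨_, r, ?_, ⟨_, _, _, _, _, _, hres, rfl⟩, ?_⟩
    · simp only [NatExpr.cost, RealExpr.cost, Test.cost, mul_assoc]
      omega
    · rw [blockEdges, if_neg ht, List.append_nil]
      exact o3

end

/-! ### The algorithm -/

namespace FrozenGraph

variable {n m : ℕ} (G : FrozenGraph (Fin n) (Fin m))

/-- `G` has a non-negative edge from `x` to `y` of weight `w`. -/
def Arc (x y : ℕ) (w : ℝ) : Prop :=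
  ∃ e, G.neg e = false ∧ (G.src e : ℕ) = x ∧ (G.tgt e : ℕ) = y ∧ G.weight e = w

theorem bounded_arc : Bounded n G.Arc := by
  rintro x y w ⟨e, hn, rfl, rfl, rfl⟩
  exact ⟨(G.src e).2, (G.tgt e).2, G.weight_nonneg e hn⟩

end FrozenGraph

namespace Program
open NatExpr Test

/-- Compute the row offsets of the adjacency matrices. -/
def rowOffsets : Program :=
  forLoop 5 0 (seq (setArr 3 (.reg 5) (.reg 4)) (setReg 4 (.add (.reg 4) (.reg 0))))

/-- Enter the edge in register `5` into the list of negative edges or into the matrices. -/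
def readStep : Program :=
  ite (natLt (.const 0) (.get 2 (.reg 5)))
    (seq (setArr 6 (.reg 2) (.reg 5)) (setReg 2 (.add (.reg 2) (.const 1))))
    (seq (setArr 4 (.add (.get 3 (.get 0 (.reg 5))) (.get 1 (.reg 5))) (.const 1))
      (seq (setRArr 1 (.add (.get 3 (.get 0 (.reg 5))) (.get 1 (.reg 5))) (.get 0 (.reg 5)))
        (seq (setArr 5 (.add (.get 3 (.get 1 (.reg 5))) (.get 0 (.reg 5))) (.const 1))
          (setRArr 2 (.add (.get 3 (.get 1 (.reg 5))) (.get 0 (.reg 5))) (.get 0 (.reg 5))))))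

/-- The hop reduction algorithm. -/
def main : Program :=
  seq rowOffsets (seq (forLoop 5 1 readStep) (seq (forLoop 11 2 process)
    (setReg 0 (.add (.reg 0) (.reg 2)))))

end Program

/-! ### Reading the edge list into adjacency matrices -/

section

variable {n m : ℕ} {G : FrozenGraph (Fin n) (Fin m)}

/-- `F` and `W` hold the matrix of the non-negative edges with number below `i`, the rows and
columns of which are given by the end points `a` and `c`. -/
def HoldsPrefix (G : FrozenGraph (Fin n) (Fin m)) (a c : Fin m → Fin n) (i : ℕ) (F : ℕ → ℕ)
    (W : ℕ → ℝ) : Prop :=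
  ∀ x < n, ∀ y < n, ∀ w,
    (∃ e : Fin m, (e : ℕ) < i ∧ G.neg e = false ∧ (a e : ℕ) = x ∧ (c e : ℕ) = y ∧ G.weight e = w) ↔
      F (x * n + y) ≠ 0 ∧ W (x * n + y) = w

theorem HoldsPrefix.step_of_neg {a c : Fin m → Fin n} {e₀ : Fin m} {F : ℕ → ℕ} {W : ℕ → ℝ}
    (h : HoldsPrefix G a c e₀ F W) (he : G.neg e₀ = true) : HoldsPrefix G a c (e₀ + 1) F W := by
  intro x hx y hy w
  rw [← h x hx y hy w]
  constructor
  · rintro ⟨e, hlt, hn, h'⟩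
    refine ⟨e, ?_, hn, h'⟩
    have : e ≠ e₀ := by rintro rfl; simp [he] at hn
    have := Fin.val_ne_of_ne this
    omega
  · rintro ⟨e, hlt, h'⟩
    exact ⟨e, by omega, h'⟩

/-- A matrix cell stores one weight. The hypothesis `hd` guarantees that the cell written for `e₀`
belongs to no other non-negative edge. -/
theorem HoldsPrefix.step {a c : Fin m → Fin n} {e₀ : Fin m} {F : ℕ → ℕ} {W : ℕ → ℝ}
    (h : HoldsPrefix G a c e₀ F W) (he : G.neg e₀ = false)
    (hd : ∀ e, a e = a e₀ → c e = c e₀ → G.neg e = false → e = e₀) :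
    HoldsPrefix G a c (e₀ + 1) (Function.update F (a e₀ * n + c e₀) 1)
      (Function.update W (a e₀ * n + c e₀) (G.weight e₀)) := by
  intro x hx y hy w
  by_cases hxy : (a e₀ : ℕ) = x ∧ (c e₀ : ℕ) = y
  · obtain ⟨rfl, rfl⟩ := hxy
    simp only [Function.update_self]
    constructor
    · rintro ⟨e, -, hn, h1, h2, rfl⟩
      rw [hd e (Fin.ext h1) (Fin.ext h2) hn]
      simp
    · rintro ⟨-, rfl⟩
      exact ⟨e₀, by omega, he, rfl, rfl, rfl⟩
  · have hne : x * n + y ≠ a e₀ * n + c e₀ := by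
      intro heq
      have hc := (c e₀).2
      have h1 : x = a e₀ := by
        -- Division by `n` recovers the row, because both column indices are below `n`; so distinct
        -- pairs have distinct addresses.
        have := congrArg (· / n) heq
        simpa [Nat.add_div_of_dvd_right, Nat.mul_add_div, Nat.div_eq_of_lt hy, Nat.div_eq_of_lt hc,
          Nat.mul_comm _ n, Nat.mul_add_div (by omega : 0 < n)] using this
      subst h1
      exact hxy ⟨rfl, by omega⟩
    rw [Function.update_of_ne hne, Function.update_of_ne hne, ← h x hx y hy w]
    constructor
    · rintro ⟨e, hlt, hn, h1, h2, h3⟩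
      refine ⟨e, ?_, hn, h1, h2, h3⟩
      have : e ≠ e₀ := by rintro rfl; exact hxy ⟨h1, h2⟩
      have := Fin.val_ne_of_ne this
      omega
    · rintro ⟨e, hlt, h'⟩
      exact ⟨e, by omega, h'⟩

/-- The machine cannot multiply, so the row offsets `x * n` are accumulated by addition and stored
once; afterwards a matrix cell is addressed in constant time. -/
theorem runs_rowOffsets {σ : State} (hn : σ.reg 0 = n) (h4 : σ.reg 4 = 0) :
    Runs .rowOffsets σ fun T σ' => T ≤ 14 * n + 5 ∧ ∀ x < n, σ'.arr 3 x = x * n := by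
  refine (Runs.forLoop_le (N := n) 7 (fun i τ => τ.reg 4 = i * n ∧ ∀ x < i, τ.arr 3 x = x * n)
    (by decide) (by decide) (by decide) hn (by simp [h4]) ?_).mono fun T σ' _ ⟨hT, _, h⟩ => ⟨hT, h⟩
  rintro i τ hi ⟨hI4, hI⟩ h5 h0 -
  refine .seq (.setArr (.setReg ⟨by simp [NatExpr.cost], ?_, fun x hx => ?_⟩))
  · simp [NatExpr.eval, hI4, h0, add_mul]
  · simp only [State.setReg_arr, State.setArr_arr, if_true, NatExpr.eval, h5, hI4,
      Function.update_apply]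
    split_ifs with h
    · rw [h]
    · exact hI x (by omega)

/-- The invariant of the loop that reads the edges. -/
structure ReadInv (G : FrozenGraph (Fin n) (Fin m)) (i : ℕ) (τ : State) : Prop where
  forward : HoldsPrefix G G.src G.tgt i (τ.arr 4) (τ.rarr 1)
  backward : HoldsPrefix G G.tgt G.src i (τ.arr 5) (τ.rarr 2)
  list_spec : ∀ l < τ.reg 2, ∃ e : Fin m, τ.arr 6 l = e ∧ (e : ℕ) < i ∧ G.neg e = true
  list_inj : ∀ l < τ.reg 2, ∀ l' < τ.reg 2, τ.arr 6 l = τ.arr 6 l' → l = l'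
  list_surj : ∀ e : Fin m, (e : ℕ) < i → G.neg e = true → ∃ l < τ.reg 2, τ.arr 6 l = e

theorem runs_readStep {τ : State} (e : Fin m) (hd : G.NoDuplicateEdges) (hI : ReadInv G e τ)
    (hout : Output τ G []) (hoff : ∀ x < n, τ.arr 3 x = x * n) (h5 : τ.reg 5 = e) :
    Runs .readStep τ fun T σ' => T ≤ 60 ∧ ReadInv G (e + 1) σ' := by
  have gs := hout.src e
  have gt := hout.tgt e
  have gn := hout.neg e
  have gw := hout.weight e
  have os := hoff _ (G.src e).2
  have ot := hoff _ (G.tgt e).2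
  refine .ite (fun ht => .seq (.setArr (.setReg ?_)))
    (fun ht => .seq (.setArr (.seq (.setRArr (.seq (.setArr (.setRArr ?_)))))))
  · simp only [Test.Holds, NatExpr.eval, h5, gn] at ht
    have hneg : G.neg e = true := by by_contra h; simp [h] at ht
    refine ⟨by simp [NatExpr.cost, Test.cost], ?_⟩
    constructor
    · simpa using hI.forward.step_of_neg hneg
    · simpa using hI.backward.step_of_neg hneg
    all_goals simp only [State.setReg_reg, State.setArr_reg, State.setReg_arr, State.setArr_arr,
      NatExpr.eval, h5, if_true, Function.update_apply]
    · intro l hl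
      split_ifs with h
      · exact ⟨e, rfl, by omega, hneg⟩
      · obtain ⟨e', h1, h2, h3⟩ := hI.list_spec l (by omega)
        exact ⟨e', h1, by omega, h3⟩
    · intro l hl l' hl' heq
      split_ifs at heq with h h' h'
      · omega
      · obtain ⟨e', h1, h2, h3⟩ := hI.list_spec l' (by omega)
        omega
      · obtain ⟨e', h1, h2, h3⟩ := hI.list_spec l (by omega)
        omega
      · exact hI.list_inj l (by omega) l' (by omega) heq
    · intro e' he' hn'
      rcases Nat.lt_succ_iff_lt_or_eq.1 he' with h | h
      · obtain ⟨l, hl, hl'⟩ := hI.list_surj e' h hn'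
        exact ⟨l, by omega, by rw [if_neg (by omega), hl']⟩
      · exact ⟨τ.reg 2, by omega, by simp [h]⟩
  · simp only [Test.Holds, NatExpr.eval, h5, gn] at ht
    have hneg : G.neg e = false := by by_contra h; simp [h] at ht
    refine ⟨by simp [NatExpr.cost, Test.cost, RealExpr.cost], ?_⟩
    have hf := hI.forward.step hneg fun e' h1 h2 h3 => hd _ _ h1 h2 (h3.trans hneg.symm)
    have hb := hI.backward.step hneg fun e' h1 h2 h3 => hd _ _ h2 h1 (h3.trans hneg.symm)
    constructor
    · simpa [NatExpr.eval, RealExpr.eval, h5, gs, gt, gw, os, ot] using hf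
    · simpa [NatExpr.eval, RealExpr.eval, h5, gs, gt, gw, os, ot] using hb
    · intro l hl
      obtain ⟨e', h1, h2, h3⟩ := hI.list_spec l (by simpa using hl)
      exact ⟨e', by simpa using h1, by omega, h3⟩
    · simpa using hI.list_inj
    · intro e' he' hn'
      rcases Nat.lt_succ_iff_lt_or_eq.1 he' with h | h
      · simpa using hI.list_surj e' h hn'
      · rw [Fin.ext h, hneg] at hn'
        exact absurd hn' (by decide)

/-- In a graph whose negative vertices have unique negative edges, there are as many negative
edges as negative vertices. -/
theorem NegEnum.ncard_negVertices {k : ℕ} {q us hs : ℕ → ℕ} {ws : ℕ → ℝ}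
    (hq : NegEnum G k q us hs ws) (hu : G.UniqueNegOut) : G.negVertices.ncard = k := by
  choose e he using hq.spec
  have hinj : Function.Injective fun i : Fin k => G.src (e i i.2) := by
    intro i j hij
    refine Fin.ext (hq.inj i i.2 j j.2 ?_)
    rw [(he i i.2).1, (he j j.2).1]
    congr 1
    exact (hu _ ⟨e i i.2, rfl, (he i i.2).2.1⟩).unique ⟨rfl, (he i i.2).2.1⟩
      ⟨hij.symm, (he j j.2).2.1⟩
  have : G.negVertices = (fun i : Fin k => G.src (e i i.2)) '' Set.univ := by
    ext v
    constructor
    · rintro ⟨f, rfl, hf⟩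
      obtain ⟨i, hi, hqi⟩ := hq.surj f hf
      refine ⟨⟨i, hi⟩, trivial, ?_⟩
      have h1 := (he i hi).1
      rw [hqi] at h1
      simp only [Fin.ext h1]
    · rintro ⟨i, -, rfl⟩
      exact ⟨e i i.2, rfl, (he i i.2).2.1⟩
  rw [this, Set.ncard_image_of_injective _ hinj, Set.ncard_univ, Nat.card_fin]

theorem output_inputState : Output (inputState G) G [] where
  count := by simp [inputState]
  src e := by simp [inputState]
  tgt e := by simp [inputState]
  neg e := by simp [inputState]
  weight e := by simp [inputState]
  new_src i hi := absurd hi (by simp)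
  new_tgt i hi := absurd hi (by simp)
  new_weight i hi := absurd hi (by simp)
  new_neg i hi := absurd hi (by simp)

/-- The interface between the machine and the mathematics: what follows uses only the `IsBlock` data
and the step count, which leaves the numbers `r i` of rounds open. -/
theorem runs_main (hd : G.NoDuplicateEdges) (hu : G.UniqueNegOut) {k : ℕ}
    (hk : G.negVertices.ncard = k) :
    Runs .main (inputState G) fun T σ' =>
      ∃ (q us hs : ℕ → ℕ) (ws : ℕ → ℝ) (l : ℕ → List (ℕ × ℕ × ℝ)) (r : ℕ → ℕ),
        NegEnum G k q us hs ws ∧ (∀ i < k, IsBlock n k G.Arc us hs ws i (l i) (r i)) ∧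
        Output σ' G ((List.range k).flatMap l) ∧ σ'.reg 0 = n + k ∧
        T ≤ 14 * n + 67 * m + 30 + ∑ i ∈ Finset.range k, (600 * (n + 1) * (r i + 1) + 7) := by
  have z0 : (inputState G).reg 0 = n := by simp [inputState]
  refine .seq ((runs_rowOffsets z0 (by simp [inputState])).mono fun T₁ σ₁ f₁ ⟨hT₁, hoff⟩ => ?_)
  have o1 : Output σ₁ G [] := output_inputState.congr (f₁.reg 1 (by decide)) (f₁.arr 0 (by decide))
    (f₁.arr 1 (by decide)) (f₁.arr 2 (by decide)) (f₁.rarr 0 (by decide))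
  have a0 : σ₁.reg 0 = n := (f₁.reg 0 (by decide)).trans z0
  refine .seq ((Runs.forLoop_le (N := m) 60 (fun i τ => ReadInv G i τ) (by decide) (by decide)
    (by decide) (by simpa using o1.count) ?_ ?_).mono fun T₂ σ₂ f₂ ⟨hT₂, hI⟩ => ?_)
  -- The empty matrices need no initialisation, because all unused memory of the input state is `0`.
  · have h2 : σ₁.reg 2 = 0 := (f₁.reg 2 (by decide)).trans (by simp [inputState])
    have h4 : σ₁.arr 4 = fun _ => 0 := (f₁.arr 4 (by decide)).trans (by simp [inputState])
    have h5 : σ₁.arr 5 = fun _ => 0 := (f₁.arr 5 (by decide)).trans (by simp [inputState])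
    constructor
    · intro x hx y hy w; simp [h4]
    · intro x hx y hy w; simp [h5]
    all_goals simp [h2]
  · intro i τ hi hI h5 _ f
    refine (runs_readStep ⟨i, hi⟩ hd hI (o1.congr (f.reg 1 (by decide)) (f.arr 0 (by decide))
      (f.arr 1 (by decide)) (f.arr 2 (by decide)) (f.rarr 0 (by decide)))
      (by rw [f.arr 3 (by decide)]; exact hoff) h5).mono fun T τ' _ ⟨hT, h⟩ => ⟨hT, ?_⟩
    exact ⟨h.forward, h.backward, by simpa using h.list_spec, by simpa using h.list_inj,
      by simpa using h.list_surj⟩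
  have o2 : Output σ₂ G [] := o1.congr (f₂.reg 1 (by decide)) (f₂.arr 0 (by decide))
    (f₂.arr 1 (by decide)) (f₂.arr 2 (by decide)) (f₂.rarr 0 (by decide))
  have b0 : σ₂.reg 0 = n := (f₂.reg 0 (by decide)).trans a0
  have hoff₂ : ∀ x < n, σ₂.arr 3 x = x * n := by rw [f₂.arr 3 (by decide)]; exact hoff
  set q := σ₂.arr 6 with hqdef
  set us := fun i => σ₂.arr 0 (q i) with hus
  set hs := fun i => σ₂.arr 1 (q i) with hhs
  set ws := fun i => σ₂.rarr 0 (q i) with hws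
  have hq : NegEnum G (σ₂.reg 2) q us hs ws := by
    refine ⟨fun i hi => ?_, hI.list_inj, fun e he => hI.list_surj e e.2 he⟩
    obtain ⟨e, h1, -, h2⟩ := hI.list_spec i hi
    refine ⟨e, h1, h2, ?_, ?_, ?_⟩
    · simp only [hus, hqdef, h1]; exact o2.src e
    · simp only [hhs, hqdef, h1]; exact o2.tgt e
    · simp only [hws, hqdef, h1]; exact o2.weight e
  -- Register `2` counts negative edges; as each negative vertex has exactly one, this is the number
  -- of negative vertices.
  have hk2 : σ₂.reg 2 = k := (hq.ncard_negVertices hu).symm.trans hk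
  rw [hk2] at hq
  have hkn : k ≤ n := by
    rw [← hk]
    simpa using Set.ncard_le_card G.negVertices
  have hF : HoldsMatrix σ₂ n G.Arc 4 1 := ⟨hoff₂, fun x hx y hy w => by
    rw [← hI.forward x hx y hy w]; simp [FrozenGraph.Arc]⟩
  have hB : HoldsMatrix σ₂ n (fun x y w => G.Arc y x w) 5 2 := ⟨hoff₂, fun x hx y hy w => by
    rw [← hI.backward x hx y hy w]
    simp only [FrozenGraph.Arc, Fin.is_lt, true_and]
    exact exists_congr fun e => and_congr_right fun _ => and_left_comm⟩
  refine .seq ((Runs.forLoop (N := k) (fun i T τ => ∃ (l : ℕ → List (ℕ × ℕ × ℝ)) (r : ℕ → ℕ),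
      (∀ i' < i, IsBlock n k G.Arc us hs ws i' (l i') (r i')) ∧
      Output τ G ((List.range i).flatMap l) ∧
      T ≤ 2 + ∑ i' ∈ Finset.range i, (600 * (n + 1) * (r i' + 1) + 7))
    (by decide) (by decide) (by decide) hk2 ?_ ?_).mono
      fun T₃ σ₃ f₃ ⟨T', hT', l, r, hl, ho, hT⟩ => .setReg ?_)
  · exact ⟨fun _ => [], fun _ => 0, by simp, by simpa using o2.setReg (by decide), by simp⟩
  · rintro i T τ hi ⟨l, r, hl, ho, hT⟩ h11 h2 f
    refine (runs_process (k := k) (us := us) (hs := hs) (ws := ws) ho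
      ((f.reg 0 (by decide)).trans b0) h2 hkn G.bounded_arc
      (hF.congr (f.arr 3 (by decide)) (f.arr 4 (by decide)) (f.rarr 1 (by decide)))
      (hB.congr (f.arr 3 (by decide)) (f.arr 5 (by decide)) (f.rarr 2 (by decide)))
      (by rw [f.arr 6 (by decide)]; exact hq) (by omega)).mono ?_
    rintro T' τ' - ⟨l', r', hT', hb, ho'⟩
    rw [h11] at hb
    refine ⟨Function.update l i l', Function.update r i r', fun i' hi' => ?_, ?_, ?_⟩
    · rcases Nat.lt_succ_iff_lt_or_eq.1 hi' with h | rfl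
      · rw [Function.update_of_ne h.ne, Function.update_of_ne h.ne]
        exact hl i' h
      · simpa using hb
    · have : (List.range (i + 1)).flatMap (Function.update l i l') =
          (List.range i).flatMap l ++ l' := by
        rw [List.range_succ, List.flatMap_append, List.flatMap_singleton, Function.update_self]
        congr 1
        refine List.flatMap_congr fun x hx => ?_
        rw [Function.update_of_ne (List.mem_range.1 hx).ne]
      rw [this]
      exact ho'.setReg (by decide)
    · have hsum : ∀ x ∈ Finset.range i,
          600 * (n + 1) * (Function.update r i r' x + 1) + 7 = 600 * (n + 1) * (r x + 1) + 7 := by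
        intro x hx
        rw [Function.update_of_ne (Finset.mem_range.1 hx).ne]
      rw [Finset.sum_range_succ, Finset.sum_congr rfl hsum, Function.update_self]
      omega
  · refine ⟨q, us, hs, ws, l, r, hq, hl, ?_, ?_, ?_⟩
    · exact ho.setReg (by decide)
    · have c0 : σ₃.reg 0 = n := (f₃.reg 0 (by decide)).trans b0
      have c2 : σ₃.reg 2 = k := (f₃.reg 2 (by decide)).trans hk2
      simp [NatExpr.eval, c0, c2]
    · simp only [NatExpr.cost]
      omega

end

/-! ### Walks and supergraphs -/

namespace FrozenGraph

section

variable {V E : Type*} {G : FrozenGraph V E}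

theorem IsWalk.append {s t u : V} {p q : List E} (hp : G.IsWalk s p t) (hq : G.IsWalk t q u) :
    G.IsWalk s (p ++ q) u := by
  induction p generalizing s with
  | nil => cases hp; exact hq
  | cons e p ih => exact ⟨hp.1, ih hp.2⟩

theorem isWalk_singleton (e : E) : G.IsWalk (G.src e) [e] (G.tgt e) := ⟨rfl, rfl⟩

theorem walkWeight_append (p q : List E) :
    G.walkWeight (p ++ q) = G.walkWeight p + G.walkWeight q := by
  simp [walkWeight]

theorem walkWeight_cons (e : E) (p : List E) :
    G.walkWeight (e :: p) = G.weight e + G.walkWeight p := by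
  simp [walkWeight]

theorem walkWeight_singleton (e : E) : G.walkWeight [e] = G.weight e := by
  simp [walkWeight]

theorem hops_append (p q : List E) : G.hops (p ++ q) = G.hops p + G.hops q :=
  List.countP_append

theorem hops_cons (e : E) (p : List E) :
    G.hops (e :: p) = G.hops p + if G.neg e = true then 1 else 0 :=
  List.countP_cons

theorem hops_singleton_le (e : E) : G.hops [e] ≤ 1 := List.countP_le_length

theorem hops_singleton_of_not_neg {e : E} (h : G.neg e = false) : G.hops [e] = 0 := by
  simp [hops, h]

/-- A walk with a negative edge splits at the first one. -/
theorem IsWalk.split {s t : V} {p : List E} (h : G.IsWalk s p t) (hp : 0 < G.hops p) :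
    ∃ p₀ e p₁, p = p₀ ++ e :: p₁ ∧ G.neg e = true ∧ G.hops p₀ = 0 ∧ G.hops p₁ + 1 = G.hops p ∧
      G.IsWalk s p₀ (G.src e) ∧ G.IsWalk (G.tgt e) p₁ t := by
  induction p generalizing s with
  | nil => simp [hops] at hp
  | cons e p ih =>
    by_cases he : G.neg e = true
    · exact ⟨[], e, p, rfl, he, rfl, by simp [hops_cons, he], h.1.symm, h.2⟩
    · rw [hops_cons, if_neg he] at hp
      obtain ⟨p₀, e', p₁, rfl, h1, h2, h3, h4, h5⟩ := ih h.2 hp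
      refine ⟨e :: p₀, e', p₁, rfl, h1, ?_, ?_, ⟨h.1, h4⟩, h5⟩
      · rw [hops_cons, if_neg he, h2]
      · rw [hops_cons, if_neg he, h3, add_zero]

end

section

variable {V E V' E' : Type*} {G : FrozenGraph V E} {G' : FrozenGraph V' E'} {i : V ↪ V'}
  {j : E ↪ E'}

theorem IsSupergraph.isWalk (h : G.IsSupergraph G' i j) {s t : V} {p : List E}
    (hp : G.IsWalk s p t) : G'.IsWalk (i s) (p.map j) (i t) := by
  induction p generalizing s with
  | nil => cases hp; rfl
  | cons e p ih =>
    refine ⟨by rw [h.src_eq, hp.1], ?_⟩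
    rw [h.tgt_eq]
    exact ih hp.2

theorem IsSupergraph.walkWeight (h : G.IsSupergraph G' i j) (p : List E) :
    G'.walkWeight (p.map j) = G.walkWeight p := by
  simp [FrozenGraph.walkWeight, Function.comp_def, h.weight_eq]

theorem IsSupergraph.hops (h : G.IsSupergraph G' i j) (p : List E) :
    G'.hops (p.map j) = G.hops p := by
  simp [FrozenGraph.hops, List.countP_map, Function.comp_def, h.neg_eq]

/-- A supergraph has the same distances, if each edge `e'` corresponds to a walk, the length of
which differs from the weight of `e'` by a difference of potentials. -/
theorem IsSupergraph.dist_eq (h : G.IsSupergraph G' i j) (π : V' → V) (φ : V' → ℝ)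
    (hπ : ∀ v, π (i v) = v) (hφ : ∀ v, φ (i v) = 0)
    (he : ∀ e', ∃ p, G.IsWalk (π (G'.src e')) p (π (G'.tgt e')) ∧
      G.walkWeight p = G'.weight e' - φ (G'.src e') + φ (G'.tgt e')) (s t : V) :
    G'.dist (i s) (i t) = G.dist s t := by
  apply le_antisymm
  · refine le_iInf₂ fun p hp => ?_
    refine iInf₂_le_of_le _ (h.isWalk hp) ?_
    rw [h.walkWeight]
  -- Concatenating the walks that correspond to the edges, the potentials of inner vertices cancel.
  · have key : ∀ (p' : List E') (s' t' : V'), G'.IsWalk s' p' t' → ∃ p, G.IsWalk (π s') p (π t') ∧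
        G.walkWeight p = G'.walkWeight p' - φ s' + φ t' := by
      intro p'
      induction p' with
      | nil =>
        rintro s' t' hp'
        cases hp'
        exact ⟨[], rfl, by simp [FrozenGraph.walkWeight]⟩
      | cons e' p' ih =>
        rintro s' t' ⟨rfl, hp'⟩
        obtain ⟨p, h1, h2⟩ := ih _ _ hp'
        obtain ⟨q, h3, h4⟩ := he e'
        refine ⟨q ++ p, h3.append h1, ?_⟩
        rw [walkWeight_append, walkWeight_cons, h2, h4]
        ring
    refine le_iInf₂ fun p' hp' => ?_
    obtain ⟨p, h1, h2⟩ := key p' _ _ hp'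
    rw [hπ, hπ] at h1
    refine iInf₂_le_of_le _ h1 ?_
    rw [h2, hφ, hφ, sub_zero, add_zero]

/-- If any three consecutive negative edges can be replaced with two, then the number of negative
edges can be reduced by a third. -/
theorem IsSupergraph.hopDist_le (h : G.IsSupergraph G' i j)
    (hsc : ∀ e₁ e₂ e₃ p₁ p₂, G.neg e₁ = true → G.neg e₂ = true → G.neg e₃ = true →
      G.IsWalk (G.tgt e₁) p₁ (G.src e₂) → G.IsWalk (G.tgt e₂) p₂ (G.src e₃) →
      G.hops p₁ = 0 → G.hops p₂ = 0 →
      ∃ p', G'.IsWalk (i (G.src e₁)) p' (i (G.tgt e₃)) ∧ G'.hops p' ≤ 2 ∧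
        G'.walkWeight p' ≤
          G.weight e₁ + G.walkWeight p₁ + G.weight e₂ + G.walkWeight p₂ + G.weight e₃)
    (s t : V) (k : ℕ) : G'.hopDist (k - k / 3) (i s) (i t) ≤ G.hopDist k s t := by
  -- Strong induction on the number of negative edges: cut off the walk after its third negative
  -- edge, and replace those three with at most two.
  have key : ∀ (N : ℕ) (p : List E) (s : V), G.hops p ≤ N → G.IsWalk s p t →
      ∃ p', G'.IsWalk (i s) p' (i t) ∧ G'.hops p' ≤ G.hops p - G.hops p / 3 ∧
        G'.walkWeight p' ≤ G.walkWeight p := by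
    intro N
    induction N using Nat.strong_induction_on with
    | _ N ih =>
      intro p s hN hp
      by_cases h3 : G.hops p < 3
      · exact ⟨p.map j, h.isWalk hp, by rw [h.hops]; omega, (h.walkWeight p).le⟩
      · obtain ⟨p₀, e₁, q₁, rfl, n1, z0, c1, w0, w1⟩ := hp.split (by omega)
        obtain ⟨p₁, e₂, q₂, rfl, n2, z1, c2, w2, w3⟩ := w1.split (by omega)
        obtain ⟨p₂, e₃, q₃, rfl, n3, z2, c3, w4, w5⟩ := w3.split (by omega)
        obtain ⟨p', g1, g2, g3⟩ := hsc e₁ e₂ e₃ p₁ p₂ n1 n2 n3 w2 w4 z1 z2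
        obtain ⟨q', g4, g5, g6⟩ := ih (G.hops q₃) (by omega) q₃ _ le_rfl w5
        refine ⟨p₀.map j ++ (p' ++ q'), (h.isWalk w0).append (g1.append g4), ?_, ?_⟩
        · rw [hops_append, hops_append, h.hops]
          omega
        · simp only [walkWeight_append, walkWeight_cons, h.walkWeight]
          linarith
  refine le_iInf₂ fun p hp => ?_
  obtain ⟨p', h1, h2, h3⟩ := key _ p s le_rfl hp.1
  refine iInf₂_le_of_le p' ⟨h1, ?_⟩ (EReal.coe_le_coe_iff.2 h3)
  -- The function `k - k / 3` is monotone in `k`, so the bound for the actual number of hops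
  -- suffices.
  have := hp.2
  omega

end

/-! ### The extended graph -/

section

variable {n m : ℕ} {G : FrozenGraph (Fin n) (Fin m)}

theorem IsWalk.path {s t : Fin n} {p : List (Fin m)} (h : G.IsWalk s p t) (hp : G.hops p = 0) :
    Path G.Arc s t (G.walkWeight p) := by
  induction p generalizing s with
  | nil => cases h; exact .refl _
  | cons e p ih =>
    rw [hops_cons, Nat.add_eq_zero_iff] at hp
    rw [walkWeight_cons]
    refine Path.cons ⟨e, ?_, congrArg _ h.1, rfl, rfl⟩ (ih h.2 hp.1)
    simpa using hp.2

theorem exists_walk_of_path {s t : Fin n} {W : ℝ} (h : Path G.Arc s t W) :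
    ∃ p, G.IsWalk s p t ∧ G.hops p = 0 ∧ G.walkWeight p = W := by
  generalize ht : (t : ℕ) = y at h
  induction h generalizing t with
  | refl =>
    obtain rfl := Fin.ext ht
    exact ⟨[], rfl, rfl, by simp [walkWeight]⟩
  | snoc _ he ih =>
    obtain ⟨e, hn, rfl, h2, rfl⟩ := he
    obtain ⟨p, h3, h4, h5⟩ := ih rfl
    obtain rfl := Fin.ext (h2.trans ht.symm)
    refine ⟨p ++ [e], h3.append (isWalk_singleton e), ?_, ?_⟩
    · rw [hops_append, h4, hops_singleton_of_not_neg hn]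
    · rw [walkWeight_append, h5, walkWeight_singleton]

/-- The graph `G` with `k` additional vertices and the additional edges `L`. -/
noncomputable def extend (G : FrozenGraph (Fin n) (Fin m)) (k : ℕ) (L : List (ℕ × ℕ × ℝ))
    (hL : ∀ e ∈ L, e.1 < n + k ∧ e.2.1 < n + k) :
    FrozenGraph (Fin (n + k)) (Fin (m + L.length)) where
  src := Fin.addCases (fun e => Fin.castAdd k (G.src e))
    (fun i => ⟨L[i].1, (hL _ (List.getElem_mem _)).1⟩)
  tgt := Fin.addCases (fun e => Fin.castAdd k (G.tgt e))
    (fun i => ⟨L[i].2.1, (hL _ (List.getElem_mem _)).2⟩)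
  weight := Fin.addCases G.weight (fun i => L[i].2.2)
  neg := Fin.addCases G.neg (fun i => decide (L[i].2.2 < 0))
  weight_nonneg := by
    refine Fin.addCases (fun e he => ?_) (fun i hi => ?_)
    · simp only [Fin.addCases_left] at he ⊢
      exact G.weight_nonneg e he
    · rw [Fin.addCases_right, decide_eq_false_iff_not] at hi
      rw [Fin.addCases_right]
      exact le_of_not_gt hi

variable {k : ℕ} {L : List (ℕ × ℕ × ℝ)} {hL : ∀ e ∈ L, e.1 < n + k ∧ e.2.1 < n + k}

section

variable (e : Fin m) (i : Fin L.length)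

@[simp] theorem extend_src_castAdd :
    (G.extend k L hL).src (Fin.castAdd _ e) = Fin.castAdd k (G.src e) := by simp [extend]
@[simp] theorem extend_tgt_castAdd :
    (G.extend k L hL).tgt (Fin.castAdd _ e) = Fin.castAdd k (G.tgt e) := by simp [extend]
@[simp] theorem extend_weight_castAdd :
    (G.extend k L hL).weight (Fin.castAdd _ e) = G.weight e := by simp [extend]
@[simp] theorem extend_neg_castAdd :
    (G.extend k L hL).neg (Fin.castAdd _ e) = G.neg e := by simp [extend]
@[simp] theorem extend_src_natAdd :
    (G.extend k L hL).src (Fin.natAdd m i) = ⟨L[i].1, (hL _ (List.getElem_mem _)).1⟩ :=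
  by simp [extend]
@[simp] theorem extend_tgt_natAdd :
    (G.extend k L hL).tgt (Fin.natAdd m i) = ⟨L[i].2.1, (hL _ (List.getElem_mem _)).2⟩ :=
  by simp [extend]
@[simp] theorem extend_weight_natAdd :
    (G.extend k L hL).weight (Fin.natAdd m i) = L[i].2.2 := by simp [extend]
@[simp] theorem extend_neg_natAdd :
    (G.extend k L hL).neg (Fin.natAdd m i) = decide (L[i].2.2 < 0) := by simp [extend]

end

theorem isSupergraph_extend :
    G.IsSupergraph (G.extend k L hL) (Fin.castAddEmb k) (Fin.castLEEmb (Nat.le_add_right _ _)) where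
  src_eq e := extend_src_castAdd e
  tgt_eq e := extend_tgt_castAdd e
  weight_eq e := extend_weight_castAdd e
  neg_eq e := extend_neg_castAdd e
  new_neg := by
    refine Fin.addCases (fun e he => absurd ⟨e, rfl⟩ he) (fun i _ => ?_)
    simp

/-- Each new edge of the list is an edge of the extended graph. -/
theorem exists_edge_extend {a c : Fin (n + k)} {w : ℝ} (h : ((a : ℕ), (c : ℕ), w) ∈ L) :
    ∃ e', (G.extend k L hL).src e' = a ∧ (G.extend k L hL).tgt e' = c ∧
      (G.extend k L hL).weight e' = w ∧ (0 ≤ w → (G.extend k L hL).neg e' = false) := by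
  obtain ⟨i, hi⟩ := List.get_of_mem h
  simp only [List.get_eq_getElem] at hi
  refine ⟨Fin.natAdd m i, ?_, ?_, ?_, fun hw => ?_⟩
  · simp [hi]
  · simp [hi]
  · simp [hi]
  · simpa [hi] using hw

theorem _root_.HopReduction.Output.encodes {σ : State} (h : Output σ G L) (h0 : σ.reg 0 = n + k) :
    Encodes σ (G.extend k L hL) where
  vertices := h0
  edges := h.count
  src := by
    refine Fin.addCases (fun e => ?_) (fun i => ?_)
    · simpa using h.src e
    · simpa using h.new_src i i.2
  tgt := by
    refine Fin.addCases (fun e => ?_) (fun i => ?_)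
    · simpa using h.tgt e
    · simpa using h.new_tgt i i.2
  neg := by
    refine Fin.addCases (fun e => ?_) (fun i => ?_)
    · simpa using h.neg e
    · simpa using h.new_neg i i.2
  weight := by
    refine Fin.addCases (fun e => ?_) (fun i => ?_)
    · simpa using h.weight e
    · simpa using h.new_weight i i.2

theorem negVertices_extend
    (h : ∀ e ∈ L, e.2.2 < 0 → ∃ v ∈ G.negVertices, e.1 = (v : ℕ)) :
    (G.extend k L hL).negVertices = Fin.castAdd k '' G.negVertices := by
  ext v
  constructor
  · rintro ⟨e', rfl, hn⟩
    induction e' using Fin.addCases with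
    | left e =>
      simp only [extend_neg_castAdd, extend_src_castAdd] at hn ⊢
      exact ⟨_, ⟨e, rfl, hn⟩, rfl⟩
    | right i =>
      simp only [extend_neg_natAdd, extend_src_natAdd, decide_eq_true_eq] at hn ⊢
      obtain ⟨v, hv, h'⟩ := h _ (List.getElem_mem _) hn
      exact ⟨v, hv, Fin.ext h'.symm⟩
  · rintro ⟨_, ⟨e, rfl, hn⟩, rfl⟩
    exact ⟨Fin.castAdd _ e, by simp, by simpa using hn⟩

end

end FrozenGraph

/-! ### Properties of the new edges -/

section

variable {n m k j r : ℕ} {G : FrozenGraph (Fin n) (Fin m)} {q us hs : ℕ → ℕ} {ws : ℕ → ℝ}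
  {l : List (ℕ × ℕ × ℝ)}

/-- The new edge `e` corresponds to a walk in `G`, where the Steiner vertex `n + j` stands for the
vertex `u` with potential `φ`; if the weight of `e` is negative, then so is its source. -/
def EdgeSound (G : FrozenGraph (Fin n) (Fin m)) (u : Fin n) (j : ℕ) (φ : ℝ) (e : ℕ × ℕ × ℝ) :
    Prop :=
  (∃ s t : Fin n, e.1 = s ∧ e.2.1 = t ∧ (∃ p, G.IsWalk s p t ∧ G.walkWeight p = e.2.2) ∧
    (e.2.2 < 0 → s ∈ G.negVertices)) ∨
  (∃ s : Fin n, e.1 = s ∧ e.2.1 = n + j ∧ 0 ≤ e.2.2 ∧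
    ∃ p, G.IsWalk s p u ∧ G.walkWeight p = e.2.2 + φ) ∨
  (∃ t : Fin n, e.1 = n + j ∧ e.2.1 = t ∧ 0 ≤ e.2.2 ∧
    ∃ p, G.IsWalk u p t ∧ G.walkWeight p = e.2.2 - φ)

theorem FrozenGraph.exists_walk_merge {e₁ e₂ : Fin m} {W : ℝ}
    (h : Path G.Arc (G.tgt e₁) (G.src e₂) W) :
    ∃ p, G.IsWalk (G.src e₁) p (G.tgt e₂) ∧ G.walkWeight p = G.weight e₁ + W + G.weight e₂ := by
  obtain ⟨p, hp, -, hw⟩ := FrozenGraph.exists_walk_of_path h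
  refine ⟨[e₁] ++ (p ++ [e₂]), (isWalk_singleton e₁).append (hp.append (isWalk_singleton e₂)), ?_⟩
  rw [walkWeight_append, walkWeight_append, walkWeight_singleton, walkWeight_singleton, hw]
  ring

/-- Labels are lengths of actual paths, so a merged edge is the weight of a concrete walk, and the
shift by the potential at the Steiner vertex is undone after passing it. -/
theorem IsBlock.sound (hb : IsBlock n k G.Arc us hs ws j l r) (hq : NegEnum G k q us hs ws)
    (hj : j < k) {u : Fin n} (hu : us j = u) : ∃ φ, ∀ e ∈ l, EdgeSound G u j φ e := by
  obtain ⟨sB, lB, sF, lF, b, f, hres, rfl⟩ := hb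
  obtain ⟨e₀, -, hn₀, hu₀, hh₀, hw₀⟩ := hq.spec j hj
  obtain rfl : u = G.src e₀ := Fin.ext (hu.symm.trans hu₀)
  -- The potential of the Steiner vertex is the least tentative backward label.
  refine ⟨lB b, fun e he => ?_⟩
  have pB : ∀ x < n, sB x ≠ 0 → Path G.Arc x (us j) (lB x) := fun x hx h =>
    (hres.backward.path x hx h).reverse
  have pF := hres.forward.path
  rcases List.mem_append.1 he with he | he
  · obtain ⟨i, hi, he⟩ := List.mem_flatMap.1 he
    obtain ⟨e₁, -, hn₁, hu₁, hh₁, hw₁⟩ := hq.spec i (List.mem_range.1 hi)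
    rcases List.mem_append.1 he with he | he
    · split_ifs at he with h
      · obtain rfl := List.mem_singleton.1 he
        have h' := pB _ (G.tgt e₁).2 (by rw [← hh₁]; omega)
        rw [hu₀] at h'
        refine .inl ⟨G.src e₁, G.tgt e₀, hu₁, hh₀, ?_, fun _ => ⟨e₁, rfl, hn₁⟩⟩
        obtain ⟨p, hp, hw⟩ := FrozenGraph.exists_walk_merge h'
        exact ⟨p, hp, by rw [hw, hw₁, hw₀, hh₁]⟩
      · simp at he
    · split_ifs at he with h
      · obtain rfl := List.mem_singleton.1 he
        have h' := pF _ (G.src e₁).2 (by rw [← hu₁]; omega)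
        rw [hh₀] at h'
        refine .inl ⟨G.src e₀, G.tgt e₁, hu₀, hh₁, ?_, fun _ => ⟨e₀, rfl, hn₀⟩⟩
        obtain ⟨p, hp, hw⟩ := FrozenGraph.exists_walk_merge h'
        exact ⟨p, hp, by rw [hw, hw₁, hw₀, hu₁]⟩
      · simp at he
  · split_ifs at he with hbf
    · obtain ⟨x, hx, he⟩ := List.mem_flatMap.1 he
      have hx := List.mem_range.1 hx
      have hB := hres.min_backward.resolve_left fun h => hbf.1.ne h.1
      have hF := hres.min_forward.resolve_left fun h => hbf.2.ne h.1
      rcases List.mem_append.1 he with he | he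
      · split_ifs at he with h
        · obtain rfl := List.mem_singleton.1 he
          have h' := pB x hx (by omega)
          rw [hu₀] at h'
          obtain ⟨p, hp, -, hw⟩ := FrozenGraph.exists_walk_of_path (s := ⟨x, hx⟩) h'
          exact .inr (.inl ⟨⟨x, hx⟩, rfl, rfl, sub_nonneg.2 (hB.2.2 x hx h), p, hp, by simp [hw]⟩)
        · simp at he
      · split_ifs at he with h
        · obtain rfl := List.mem_singleton.1 he
          have h' := pF x hx (by omega)
          rw [hh₀] at h'
          obtain ⟨p, hp, -, hw⟩ := FrozenGraph.exists_walk_of_path (t := ⟨x, hx⟩) h'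
          refine .inr (.inr ⟨⟨x, hx⟩, rfl, rfl, ?_, e₀ :: p, ⟨rfl, hp⟩, ?_⟩)
          -- The least forward label `lF f` is at most `lF x`, so the stopping rule makes this
          -- weight non-negative.
          · have := hres.label_sum_nonneg hbf.1 hbf.2
            have := hF.2.2 x hx h
            simp only
            linarith
          · rw [G.walkWeight_cons, hw, hw₀]
            ring
        · simp at he
    · simp at he

/-- The new edges replace two of three consecutive negative edges, the second of which is the
`j`-th one, with one edge, or they bypass the second one by non-negative edges. -/
theorem IsBlock.shortcut (hb : IsBlock n k G.Arc us hs ws j l r) (huj : us j < n) (hhj : hs j < n)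
    {i₁ i₃ : ℕ} (h₁ : i₁ < k) (h₃ : i₃ < k) {W₁ W₂ : ℝ} (hh₁ : hs i₁ < n) (hu₃ : us i₃ < n)
    (p₁ : Path G.Arc (hs i₁) (us j) W₁) (p₂ : Path G.Arc (hs j) (us i₃) W₂) :
    (∃ w ≤ ws i₁ + W₁ + ws j, (us i₁, hs j, w) ∈ l) ∨
    (∃ w ≤ ws j + W₂ + ws i₃, (us j, hs i₃, w) ∈ l) ∨
    (∃ x < n, ∃ y < n, ∃ w ≥ 0, ∃ w' ≥ 0, ∃ V₁ V₂, Path G.Arc (hs i₁) x V₁ ∧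
      (x, n + j, w) ∈ l ∧ (n + j, y, w') ∈ l ∧ Path G.Arc y (us i₃) V₂ ∧
      V₁ + w + w' + V₂ ≤ W₁ + ws j + W₂) := by
  obtain ⟨sB, lB, sF, lF, b, f, hres, rfl⟩ := hb
  have hAB : Bounded n fun x y w => G.Arc y x w := fun x y w h =>
    ⟨(G.bounded_arc _ _ _ h).2.1, (G.bounded_arc _ _ _ h).1, (G.bounded_arc _ _ _ h).2.2⟩
  by_cases hB : sB (hs i₁) = 2
  · left
    refine ⟨ws i₁ + lB (hs i₁) + ws j, ?_, ?_⟩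
    · have := hres.backward.lab_le hAB huj hh₁ hB p₁.reverse
      linarith
    · refine List.mem_append_left _ (List.mem_flatMap.2 ⟨i₁, List.mem_range.2 h₁, ?_⟩)
      simp [mergeEdges, hB]
  by_cases hF : sF (us i₃) = 2
  · right; left
    refine ⟨ws j + lF (us i₃) + ws i₃, ?_, ?_⟩
    · have := hres.forward.lab_le G.bounded_arc hhj hu₃ hF p₂
      linarith
    · refine List.mem_append_left _ (List.mem_flatMap.2 ⟨i₃, List.mem_range.2 h₃, ?_⟩)
      simp [mergeEdges, hF]
  right; right
  -- Neither end is settled, so both connecting paths yield tentative vertices; in particular both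
  -- minima exist and the Steiner edges were written.
  obtain ⟨x, hx, hx1, V₁, q₁, hV₁⟩ := hres.backward.exists_tentative hAB huj hB p₁.reverse
  obtain ⟨y, hy, hy1, V₂, q₂, hV₂⟩ := hres.forward.exists_tentative G.bounded_arc hhj hF p₂
  have hmb := hres.min_backward.resolve_left fun h => h.2 x hx hx1
  have hmf := hres.min_forward.resolve_left fun h => h.2 y hy hy1
  have hsum := hres.label_sum_nonneg hmb.1 hmf.1
  have hxb := hmb.2.2 x hx hx1
  have hyf := hmf.2.2 y hy hy1
  have hmem : ∀ z < n, ∀ e ∈ steinerEdges (n + j) b (ws j) sB lB sF lF z,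
      e ∈ blockEdges n k us hs ws (us j) (hs j) (n + j) (ws j) sB lB sF lF b f := by
    intro z hz e he
    refine List.mem_append_right _ ?_
    rw [if_pos ⟨hmb.1, hmf.1⟩]
    exact List.mem_flatMap.2 ⟨z, List.mem_range.2 hz, he⟩
  -- In the total weight of the detour `lB b` cancels, which leaves `(V₁ + lB x) + ws j + (lF y +
  -- V₂)`.
  refine ⟨x, hx, y, hy, lB x - lB b, by simpa using hxb, ws j + lF y + lB b, by
    simp only [ge_iff_le]; linarith, V₁, V₂, q₁.reverse, hmem x hx _ (by simp [steinerEdges, hx1]),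
    hmem y hy _ (by simp [steinerEdges, hy1]), q₂, by linarith⟩

/-! ### Counting the rounds -/

theorem card_filter_fin (p : ℕ → Prop) [DecidablePred p] :
    (Finset.univ.filter fun x : Fin n => p x).card = ((Finset.range n).filter p).card := by
  rw [← Finset.card_map Fin.valEmbedding]
  congr 1
  ext x
  simp only [Finset.mem_map, Finset.mem_filter, Finset.mem_univ, true_and, Fin.valEmbedding_apply,
    Finset.mem_range]
  exact ⟨fun ⟨a, ha, h⟩ => h ▸ ⟨a.2, ha⟩, fun ⟨hx, h⟩ => ⟨⟨x, hx⟩, h, rfl⟩⟩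

open Classical in
/-- The number of rounds is bounded by the number of pairs with the current vertex between them. -/
theorem IsBlock.sq_le (hb : IsBlock n k G.Arc us hs ws j l r) (hq : NegEnum G k q us hs ws)
    (hj : j < k) {u : Fin n} (hu : us j = u) :
    r ^ 2 ≤ (Finset.univ.filter fun p : Fin n × Fin n => G.IsBetween p.1 p.2 u).card := by
  obtain ⟨sB, lB, sF, lF, b, f, hres, rfl⟩ := hb
  obtain ⟨e₀, -, hn₀, hu₀, hh₀, hw₀⟩ := hq.spec j hj
  obtain rfl : u = G.src e₀ := Fin.ext (hu.symm.trans hu₀)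
  -- Each side has settled `r` vertices, so `r ^ 2` is the number of settled pairs; all of them have
  -- `u` between them.
  rw [sq]
  nth_rewrite 1 [← hres.card_backward]
  rw [← hres.card_forward, ← card_filter_fin, ← card_filter_fin, ← Finset.card_product]
  refine Finset.card_le_card fun ⟨s, t⟩ hst => ?_
  simp only [Finset.mem_product, Finset.mem_filter, Finset.mem_univ, true_and] at hst ⊢
  have p₁ := (hres.backward.path s s.2 (by omega)).reverse
  have p₂ := hres.forward.path t t.2 (by omega)
  rw [hu₀] at p₁
  rw [hh₀] at p₂
  obtain ⟨w₁, a1, a2, a3⟩ := FrozenGraph.exists_walk_of_path p₁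
  obtain ⟨w₂, b1, b2, b3⟩ := FrozenGraph.exists_walk_of_path p₂
  have d₁ : G.hopDist 0 s (G.src e₀) ≤ (lB s : EReal) := by
    rw [← a3]
    exact iInf₂_le_of_le w₁ ⟨a1, a2.le⟩ le_rfl
  have d₂ : G.firstNegDist (G.src e₀) t ≤ ((ws j + lF t : ℝ) : EReal) := by
    rw [← b3, hw₀, ← G.walkWeight_cons]
    -- The negative edge `e₀` comes first, the one place where `firstNegDist` allows a negative
    -- edge.
    refine iInf₂_le_of_le (e₀ :: w₂) ⟨⟨rfl, b1⟩, fun e he => ?_⟩ le_rfl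
    have := List.countP_eq_zero.1 b2 e he
    simpa using this
  refine (add_le_add d₁ d₂).trans_lt ?_
  rw [← EReal.coe_add, ← EReal.coe_zero, EReal.coe_lt_coe_iff]
  have := hres.lt_zero s s.2 t t.2 hst.1 hst.2
  linarith

open Classical in
/-- The total number of rounds is at most `k n / √b`. -/
theorem sum_rounds_mul_sqrt_le (hu : G.UniqueNegOut) (hq : NegEnum G k q us hs ws)
    {L : ℕ → List (ℕ × ℕ × ℝ)} {R : ℕ → ℕ} (hb : ∀ i < k, IsBlock n k G.Arc us hs ws i (L i) (R i))
    {b : ℝ} (hb0 : 0 < b) (hbet : ∀ s t : Fin n, (G.betweenness s t : ℝ) ≤ (k : ℝ) / b) :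
    ((∑ i ∈ Finset.range k, R i : ℕ) : ℝ) * √b ≤ k * n := by
  choose e he using hq.spec
  set v : Fin k → Fin n := fun i => G.src (e i i.2) with hv
  have hvinj : Function.Injective v := by
    intro i i' hij
    refine Fin.ext (hq.inj i i.2 i' i'.2 ?_)
    rw [(he i i.2).1, (he i' i'.2).1]
    congr 1
    exact (hu _ ⟨e i i.2, rfl, (he i i.2).2.1⟩).unique ⟨rfl, (he i i.2).2.1⟩
      ⟨hij.symm, (he i' i'.2).2.1⟩
  have h1 : ∑ i : Fin k, R i ^ 2 ≤
      ∑ i : Fin k, (Finset.univ.filter fun p : Fin n × Fin n => G.IsBetween p.1 p.2 (v i)).card :=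
    Finset.sum_le_sum fun i _ => (hb i i.2).sq_le hq i.2 (he i i.2).2.2.1
  -- Double counting of incidences between negative vertices and the pairs they lie between.
  have h2 : ∑ i : Fin k,
      (Finset.univ.filter fun p : Fin n × Fin n => G.IsBetween p.1 p.2 (v i)).card =
      ∑ p : Fin n × Fin n, (Finset.univ.filter fun i : Fin k => G.IsBetween p.1 p.2 (v i)).card :=
    Finset.sum_card_bipartiteAbove_eq_sum_card_bipartiteBelow _
  have h3 : ∀ p : Fin n × Fin n,
      (Finset.univ.filter fun i : Fin k => G.IsBetween p.1 p.2 (v i)).card ≤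
        G.betweenness p.1 p.2 := by
    intro p
    rw [FrozenGraph.betweenness, ← Finset.card_map ⟨v, hvinj⟩, ← Set.ncard_coe_finset]
    refine Set.ncard_le_ncard ?_ (Set.toFinite _)
    intro x hx
    obtain ⟨i, hi, rfl⟩ := Finset.mem_map.1 (Finset.mem_coe.1 hx)
    exact (Finset.mem_filter.1 hi).2
  have h4 : ((∑ i : Fin k, R i ^ 2 : ℕ) : ℝ) ≤ n * n * (k / b) := by
    rw [h2] at h1
    calc ((∑ i : Fin k, R i ^ 2 : ℕ) : ℝ)
        ≤ ((∑ p : Fin n × Fin n, G.betweenness p.1 p.2 : ℕ) : ℝ) := by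
          exact_mod_cast h1.trans (Finset.sum_le_sum fun p _ => h3 p)
      _ ≤ ∑ _p : Fin n × Fin n, ((k : ℝ) / b) := by
          push_cast
          exact Finset.sum_le_sum fun p _ => hbet _ _
      _ = n * n * (k / b) := by simp
  -- Cauchy–Schwarz turns the bound on the sum of squares into one on the sum.
  have h5 : ((∑ i : Fin k, (R i : ℝ)) ^ 2) ≤ k * ∑ i : Fin k, (R i : ℝ) ^ 2 := by
    simpa using sq_sum_le_card_mul_sum_sq (s := (Finset.univ : Finset (Fin k)))
      (f := fun i => (R i : ℝ))
  rw [← Fin.sum_univ_eq_sum_range R k]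
  push_cast at h4 ⊢
  refine (pow_le_pow_iff_left₀ (by positivity) (by positivity) two_ne_zero).1 ?_
  rw [mul_pow, Real.sq_sqrt hb0.le]
  calc (∑ i : Fin k, (R i : ℝ)) ^ 2 * b ≤ k * (n * n * (k / b)) * b := by
        gcongr
        exact h5.trans (by gcongr)
    _ = (k * n) ^ 2 := by field_simp

end

/-! ### Properties of the whole output graph -/

section

variable {n m k : ℕ} {G : FrozenGraph (Fin n) (Fin m)} {q us hs : ℕ → ℕ} {ws : ℕ → ℝ}
  {l : ℕ → List (ℕ × ℕ × ℝ)} {R : ℕ → ℕ}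

/-- All new edges of the algorithm are sound. -/
theorem exists_edgeSound (hq : NegEnum G k q us hs ws)
    (hb : ∀ i < k, IsBlock n k G.Arc us hs ws i (l i) (R i)) :
    ∃ (v : Fin k → Fin n) (φ : Fin k → ℝ),
      ∀ e ∈ (List.range k).flatMap l, ∃ j : Fin k, EdgeSound G (v j) j (φ j) e := by
  choose e he using hq.spec
  choose φ hφ using fun j : Fin k => (hb j j.2).sound hq j.2 (he j j.2).2.2.1
  refine ⟨fun j => G.src (e j j.2), φ, fun x hx => ?_⟩
  obtain ⟨j, hj, hx⟩ := List.mem_flatMap.1 hx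
  exact ⟨⟨j, List.mem_range.1 hj⟩, hφ _ _ hx⟩

theorem EdgeSound.lt {u : Fin n} {j : Fin k} {φ : ℝ} {e : ℕ × ℕ × ℝ} (h : EdgeSound G u j φ e) :
    e.1 < n + k ∧ e.2.1 < n + k := by
  rcases h with ⟨s, t, h1, h2, -⟩ | ⟨s, h1, h2, -⟩ | ⟨t, h1, h2, -⟩ <;> rw [h1, h2] <;>
    constructor <;> omega

/-- Steiner edges have non-negative weight, and a merged edge leaves the tail of the first of the
two edges it merges. -/
theorem EdgeSound.negVertices {u : Fin n} {j : ℕ} {φ : ℝ} {e : ℕ × ℕ × ℝ}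
    (h : EdgeSound G u j φ e) (he : e.2.2 < 0) : ∃ v ∈ G.negVertices, e.1 = (v : ℕ) := by
  rcases h with ⟨s, t, h1, -, -, h4⟩ | ⟨s, -, -, h3, -⟩ | ⟨t, -, -, h3, -⟩
  · exact ⟨s, h4 he, h1⟩
  · exact absurd he h3.not_gt
  · exact absurd he h3.not_gt

namespace FrozenGraph

/-- The projection `π` sends each Steiner vertex to the negative vertex it stands for, and `ψ` is
its potential; both are trivial on the original vertices. -/
theorem dist_extend {L : List (ℕ × ℕ × ℝ)} {hL : ∀ e ∈ L, e.1 < n + k ∧ e.2.1 < n + k}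
    (v : Fin k → Fin n) (φ : Fin k → ℝ)
    (hs : ∀ e ∈ L, ∃ j : Fin k, EdgeSound G (v j) j (φ j) e) (s t : Fin n) :
    (G.extend k L hL).dist (Fin.castAdd k s) (Fin.castAdd k t) = G.dist s t := by
  set π : Fin (n + k) → Fin n := Fin.addCases id v with hπ
  set ψ : Fin (n + k) → ℝ := Fin.addCases (fun _ => 0) φ with hψ
  have π₁ : ∀ x, π (Fin.castAdd k x) = x := fun x => by simp [hπ]
  have π₂ : ∀ j, π (Fin.natAdd n j) = v j := fun j => by simp [hπ]
  have ψ₁ : ∀ x, ψ (Fin.castAdd k x) = 0 := fun x => by simp [hψ]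
  have ψ₂ : ∀ j, ψ (Fin.natAdd n j) = φ j := fun j => by simp [hψ]
  refine isSupergraph_extend.dist_eq π ψ π₁ ψ₁ ?_ s t
  refine Fin.addCases (fun e => ?_) (fun i => ?_)
  · refine ⟨[e], ?_, ?_⟩
    · simp only [extend_src_castAdd, extend_tgt_castAdd, π₁]
      exact isWalk_singleton e
    · simp [ψ₁, walkWeight_singleton]
  · have hmem : L[i] ∈ L := List.getElem_mem _
    obtain ⟨j, hj⟩ := hs _ hmem
    have hsrc : ∀ x : Fin (n + k), L[i].1 = x → (G.extend k L hL).src (Fin.natAdd m i) = x :=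
      fun x hx => by rw [extend_src_natAdd]; exact Fin.ext hx
    have htgt : ∀ x : Fin (n + k), L[i].2.1 = x → (G.extend k L hL).tgt (Fin.natAdd m i) = x :=
      fun x hx => by rw [extend_tgt_natAdd]; exact Fin.ext hx
    rcases hj with ⟨s, t, h1, h2, ⟨p, hp, hw⟩, -⟩ | ⟨s, h1, h2, -, p, hp, hw⟩ |
      ⟨t, h1, h2, -, p, hp, hw⟩
    · rw [hsrc (Fin.castAdd k s) h1, htgt (Fin.castAdd k t) h2, extend_weight_natAdd, π₁, π₁, ψ₁, ψ₁]
      exact ⟨p, hp, by rw [hw]; ring⟩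
    · rw [hsrc (Fin.castAdd k s) h1, htgt (Fin.natAdd n j) h2, extend_weight_natAdd, π₁, π₂, ψ₁, ψ₂]
      exact ⟨p, hp, by rw [hw]; ring⟩
    · rw [hsrc (Fin.natAdd n j) h1, htgt (Fin.castAdd k t) h2, extend_weight_natAdd, π₂, π₁, ψ₂, ψ₁]
      exact ⟨p, hp, by rw [hw]; ring⟩

theorem hopDist_extend_le {hL : ∀ e ∈ (List.range k).flatMap l, e.1 < n + k ∧ e.2.1 < n + k}
    (hq : NegEnum G k q us hs ws) (hb : ∀ i < k, IsBlock n k G.Arc us hs ws i (l i) (R i))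
    (s t : Fin n) (h : ℕ) :
    (G.extend k ((List.range k).flatMap l) hL).hopDist (h - h / 3) (Fin.castAdd k s)
      (Fin.castAdd k t) ≤ G.hopDist h s t := by
  have hsup := isSupergraph_extend (G := G) (hL := hL)
  set G' := G.extend k ((List.range k).flatMap l) hL with hG'
  refine hsup.hopDist_le ?_ s t h
  intro e₁ e₂ e₃ p₁ p₂ n₁ n₂ n₃ w₁ w₂ z₁ z₂
  have hspec : ∀ e, G.neg e = true →
      ∃ i < k, us i = G.src e ∧ hs i = G.tgt e ∧ ws i = G.weight e := by
    intro e he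
    obtain ⟨i, hi, hqi⟩ := hq.surj e he
    obtain ⟨e', h1, -, h2⟩ := hq.spec i hi
    rw [hqi] at h1
    rw [← Fin.ext h1] at h2
    exact ⟨i, hi, h2⟩
  obtain ⟨i₁, hi₁, a1, a2, a3⟩ := hspec e₁ n₁
  obtain ⟨i₂, hi₂, b1, b2, b3⟩ := hspec e₂ n₂
  obtain ⟨i₃, hi₃, c1, c2, c3⟩ := hspec e₃ n₃
  have hmem : ∀ x ∈ l i₂, x ∈ (List.range k).flatMap l := fun x hx =>
    List.mem_flatMap.2 ⟨i₂, List.mem_range.2 hi₂, hx⟩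
  have hedge : ∀ (x y : Fin (n + k)) (w : ℝ), ((x : ℕ), (y : ℕ), w) ∈ l i₂ →
      ∃ e', G'.IsWalk x [e'] y ∧ G'.walkWeight [e'] = w ∧ (0 ≤ w → G'.hops [e'] = 0) := by
    intro x y w hxy
    obtain ⟨e', rfl, rfl, rfl, g4⟩ := exists_edge_extend (G := G) (hL := hL) (hmem _ hxy)
    exact ⟨e', isWalk_singleton _, walkWeight_singleton _, fun hw =>
      hops_singleton_of_not_neg (g4 hw)⟩
  have hold : ∀ (e : Fin m), ∃ e', G'.IsWalk (Fin.castAdd k (G.src e)) [e']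
      (Fin.castAdd k (G.tgt e)) ∧ G'.walkWeight [e'] = G.weight e := by
    intro e
    refine ⟨_, hsup.isWalk (isWalk_singleton e), ?_⟩
    rw [← walkWeight_singleton, ← hsup.walkWeight]
    rfl
  have hpath : ∀ {x y : Fin n} {W : ℝ}, Path G.Arc x y W → ∃ p, G'.IsWalk (Fin.castAdd k x) p
      (Fin.castAdd k y) ∧ G'.hops p = 0 ∧ G'.walkWeight p = W := by
    intro x y W hp
    obtain ⟨p, g1, g2, g3⟩ := exists_walk_of_path hp
    exact ⟨_, hsup.isWalk g1, (hsup.hops p).trans g2, (hsup.walkWeight p).trans g3⟩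
  have hP₁ := w₁.path z₁
  have hP₂ := w₂.path z₂
  obtain ⟨f₁, f₁w, f₁v⟩ := hold e₁
  obtain ⟨f₃, f₃w, f₃v⟩ := hold e₃
  have hop := fun e => hops_singleton_le (G := G') e
  -- The block of the middle edge alone provides the replacement. A merged edge counts as at most
  -- one hop; the Steiner edges and the connecting paths count as none.
  rcases (hb i₂ hi₂).shortcut (by omega) (by omega) hi₁ hi₃ (by omega) (by omega)
    (by rw [a2, b1]; exact hP₁) (by rw [b2, c1]; exact hP₂) with
    ⟨w, hw, h'⟩ | ⟨w, hw, h'⟩ | ⟨x, hx, y, hy, w, hw, w', hw', V₁, V₂, r₁, h₁, h₂, r₂, hV⟩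
  · rw [a1, b2] at h'
    obtain ⟨f, g1, g2, -⟩ := hedge (Fin.castAdd k (G.src e₁)) (Fin.castAdd k (G.tgt e₂)) w h'
    obtain ⟨p, g3, g4, g5⟩ := hpath hP₂
    refine ⟨[f] ++ (p ++ [f₃]), g1.append (g3.append f₃w), ?_, ?_⟩
    · simp only [hops_append, g4]
      have := hop f
      have := hop f₃
      omega
    · simp only [walkWeight_append, g2, g5, f₃v]
      linarith
  · rw [b1, c2] at h'
    obtain ⟨f, g1, g2, -⟩ := hedge (Fin.castAdd k (G.src e₂)) (Fin.castAdd k (G.tgt e₃)) w h'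
    obtain ⟨p, g3, g4, g5⟩ := hpath hP₁
    refine ⟨[f₁] ++ (p ++ [f]), f₁w.append (g3.append g1), ?_, ?_⟩
    · simp only [hops_append, g4]
      have := hop f
      have := hop f₁
      omega
    · simp only [walkWeight_append, g2, g5, f₁v]
      linarith
  · rw [a2] at r₁
    rw [c1] at r₂
    obtain ⟨t₁, g1, g2, g3⟩ := hpath (y := ⟨x, hx⟩) r₁
    obtain ⟨t₂, g4, g5, g6⟩ := hpath (x := ⟨y, hy⟩) r₂
    obtain ⟨f, g7, g8, g9⟩ := hedge (Fin.castAdd k ⟨x, hx⟩) (Fin.natAdd n ⟨i₂, hi₂⟩) w h₁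
    obtain ⟨f', k1, k2, k3⟩ := hedge (Fin.natAdd n ⟨i₂, hi₂⟩) (Fin.castAdd k ⟨y, hy⟩) w' h₂
    refine ⟨[f₁] ++ (t₁ ++ ([f] ++ ([f'] ++ (t₂ ++ [f₃])))),
      f₁w.append (g1.append (g7.append (k1.append (g4.append f₃w)))), ?_, ?_⟩
    · simp only [hops_append, g2, g5, g9 hw, k3 hw']
      have := hop f₁
      have := hop f₃
      omega
    · simp only [walkWeight_append, g3, g6, g8, k2, f₁v, f₃v]
      linarith

/-- Keeps the cost of reading the edges quadratic in `n`. -/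
theorem NoDuplicateEdges.card_le (hd : G.NoDuplicateEdges) : m ≤ 2 * n ^ 2 := by
  have hinj : Function.Injective fun e => ((G.src e, G.tgt e), G.neg e) := by
    intro e f hef
    simp only [Prod.mk.injEq] at hef
    exact hd e f hef.1.1 hef.1.2 hef.2
  have := Fintype.card_le_of_injective _ hinj
  simp only [Fintype.card_fin, Fintype.card_prod, Fintype.card_bool] at this
  nlinarith

end FrozenGraph

end

/-- The running time in terms of the number `S` of rounds of all searches. -/
theorem runtime_le {n m k S : ℕ} (hm : m ≤ 2 * n ^ 2) (hk : k ≤ n) {R : ℕ → ℕ}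
    (hS : ∑ i ∈ Finset.range k, R i = S) :
    14 * n + 67 * m + 30 + ∑ i ∈ Finset.range k, (600 * (n + 1) * (R i + 1) + 7) ≤
      1000 * ((n + 1) ^ 2 + (n + 1) * S) := by
  have h : ∑ i ∈ Finset.range k, (600 * (n + 1) * (R i + 1) + 7) =
      600 * (n + 1) * (S + k) + 7 * k := by
    rw [← hS]
    rw [Finset.sum_add_distrib, ← Finset.mul_sum, Finset.sum_add_distrib]
    simp [mul_comm]
  have h2 : (n + 1) * k ≤ (n + 1) * n := Nat.mul_le_mul_left _ hk
  rw [h]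
  nlinarith [Nat.zero_le ((n + 1) * S)]

end HopReduction

/-! ### The main theorem -/

theorem theorem3p1 :
    ∃ (P : HopReduction.Program) (C : ℝ),
      ∀ (n m k : ℕ) (G : HopReduction.FrozenGraph (Fin n) (Fin m)) (b : ℝ),
        G.NoDuplicateEdges →
        G.negVertices.ncard = k →
        G.UniqueNegOut →
        1 ≤ b →
        (∀ s t : Fin n, (G.betweenness s t : ℝ) ≤ (k : ℝ) / b) →
        ∃ (T : ℕ) (σ : HopReduction.State) (m' : ℕ) (hm : m ≤ m')
          (G' : HopReduction.FrozenGraph (Fin (n + k)) (Fin m')),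
          -- on input `G` the program halts after `T` steps and its output is `G'`
          HopReduction.Exec P (HopReduction.inputState G) T σ ∧
          HopReduction.Encodes σ G' ∧
          -- running time
          (b ≤ (k : ℝ) ^ 2 → (T : ℝ) ≤ C * ((k : ℝ) * (n : ℝ) ^ 2 / √b)) ∧
          ((k : ℝ) ^ 2 < b → (T : ℝ) ≤ C * ((n : ℝ) + 1) ^ 2) ∧
          -- `G'` is a supergraph of `G` (with `n + k` vertices)
          G.IsSupergraph G' (Fin.castAddEmb k) (Fin.castLEEmb hm) ∧
          -- distances are preserved
          (∀ s t : Fin n, G'.dist (Fin.castAdd k s) (Fin.castAdd k t) = G.dist s t) ∧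
          -- hop reduction
          (∀ (s t : Fin n) (h : ℕ),
            G'.hopDist (h - h / 3) (Fin.castAdd k s) (Fin.castAdd k t) ≤ G.hopDist h s t) ∧
          -- no new negative vertices
          G'.negVertices = Fin.castAdd k '' G.negVertices := by
  -- The constant is `1000 * (4 + 2)`: if `b ≤ k ^ 2`, then `(n + 1) ^ 2` is at most 4 times and `(n
  -- + 1) * S` at most 2 times `k * n ^ 2 / √b`. In the other case 2000 would do.
  refine ⟨HopReduction.Program.main, 6000, fun n m k G b hd hk hu hb1 hbet => ?_⟩
  obtain ⟨T, σ, hexec, q, us, hs, ws, l, R, hq, hb, hout, h0, hT⟩ :=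
    HopReduction.runs_main hd hu hk
  obtain ⟨v, φ, hsound⟩ := HopReduction.exists_edgeSound hq hb
  have hL : ∀ e ∈ (List.range k).flatMap l, e.1 < n + k ∧ e.2.1 < n + k := fun e he =>
    let ⟨_, hj⟩ := hsound e he
    hj.lt
  have hkn : k ≤ n := by
    rw [← hk]
    simpa using Set.ncard_le_card G.negVertices
  have hrounds := HopReduction.sum_rounds_mul_sqrt_le hu hq hb (by linarith) hbet
  have hT' : (T : ℝ) ≤ 1000 * (((n : ℝ) + 1) ^ 2 +
      ((n : ℝ) + 1) * ((∑ i ∈ Finset.range k, R i : ℕ) : ℝ)) := by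
    exact_mod_cast hT.trans (HopReduction.runtime_le hd.card_le hkn rfl)
  generalize ((∑ i ∈ Finset.range k, R i : ℕ) : ℝ) = S at hrounds hT'
  have hsqrt : 0 < √b := Real.sqrt_pos.2 (by linarith)
  refine ⟨T, σ, _, Nat.le_add_right _ _, G.extend k _ hL, hexec, hout.encodes h0, fun hbk => ?_,
    fun hbk => ?_, HopReduction.FrozenGraph.isSupergraph_extend,
    HopReduction.FrozenGraph.dist_extend v φ hsound,
    HopReduction.FrozenGraph.hopDist_extend_le hq hb,
    HopReduction.FrozenGraph.negVertices_extend fun e he h =>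
      let ⟨_, hj⟩ := hsound e he
      hj.negVertices h⟩
  -- For `k = 0` this case would give `b ≤ 0`. Then `n ≥ 1`, which permits `n + 1 ≤ 2 * n`.
  · have hk0 : 1 ≤ k := by
      by_contra h
      obtain rfl : k = 0 := by omega
      norm_num at hbk
      linarith
    have hn1 : (1 : ℝ) ≤ n := by exact_mod_cast hk0.trans hkn
    have hsk : √b ≤ k := Real.sqrt_le_iff.2 ⟨by positivity, hbk⟩
    have hS : S ≤ k * n / √b := (le_div_iff₀ hsqrt).2 hrounds
    have h1 : (n : ℝ) ^ 2 ≤ k * n ^ 2 / √b := by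
      rw [le_div_iff₀ hsqrt, mul_comm]
      gcongr
    have h2 : ((n : ℝ) + 1) * S ≤ 2 * (k * n ^ 2 / √b) := by
      calc ((n : ℝ) + 1) * S ≤ (n + 1) * (k * n / √b) := by gcongr
        _ ≤ (2 * n) * (k * n / √b) := by gcongr; linarith
        _ = 2 * (k * n ^ 2 / √b) := by ring
    nlinarith
  · have hsk : (k : ℝ) ≤ √b := Real.le_sqrt_of_sq_le hbk.le
    -- Here `k ≤ √b`, so all searches together take at most `n` rounds.
    have hS : S ≤ n := by
      refine le_of_mul_le_mul_right (hrounds.trans ?_) hsqrt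
      rw [mul_comm]
      gcongr
    have hn0 : (0 : ℝ) ≤ n := by positivity
    nlinarith
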